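/- **Digitized quantum control problems with rational data.** Let $d,n\ge 0$ be integers and let $\mathcal H=\mathbb C^d\otimes \ell^2(\mathbb N)^{\otimes n}$ ($d$ discrete levels together with $n$ modes; $n=0$ gives the finite-dimensional systems). Here $\mathbb N=\{0,1,2,\dots\}$. On a mode with number basis $|0\rangle,|1\rangle,\dots$ let $a$ be the annihilation operator, $D(\alpha)=\exp(\alpha a^\dagger-\bar\alpha a)$ the displacement operator, and $S|k\rangle=|k+1\rangle$ the shift between neighbouring levels. A digitized quantum control problem with rational data is given by the following, where all coefficients and displacement amplitudes have rational real and imaginary parts. * A density matrix $\hat\rho_0$ on $\mathcal H$ (positive semidefinite, trace one) that is a finite linear combination of operators $|v\rangle\langle w|$, where $v,w$ are displaced number vectors $|i\rangle\otimes\bigotimes_l D(\alpha_l)|x_l\rangle$. * Finitely many controls, which are Kraus maps $\Phi_i[\hat\rho]=\sum_j \hat K_{i,j}\hat\rho \hat K_{i,j}^\dagger$, $1\le i\le N$, with finitely many Kraus operators satisfying $\sum_j\hat K_{i,j}^\dagger\hat K_{i,j}=\mathbb I$. Each $\hat K_{i,j}$ is a finite linear combination of operators $|b\rangle\langle c|\otimes\bigotimes_l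 D(\alpha_l)S^{u_l}(S^\dagger)^{v_l}$. * A set $AP$ of accessible policies. A policy is a finite sequence $\mathbf p=(p_1,\dots,p_P)$ with entries in $\{1,\dots,N\}$ and $P\ge 0$. Either $AP$ consists of all policies, or $AP$ is an explicitly listed finite set of policies. * For *expectation maximization*, an observable $\hat O$ which is a finite linear combination of operators $|b\rangle\langle c|\otimes\bigotimes_l (a_l^\dagger)^{u_l}a_l^{v_l}$ and of operators $|v\rangle\langle w|$ as above. It is Hermitian, and normalized so that the supremum of $\langle\psi|\hat O|\psi\rangle$ over unit vectors $\psi$ with finitely many nonzero coordinates in the level/number basis is $0$. For *state preparation*, a target density matrix $\hat\rho_{\rm f}$ of the same form as $\hat\rho_0$. Put $\hat\rho(\mathbf p)=\Phi_{p_P}\cdots\Phi_{p_1}[\hat\rho_0]$, $J_{\hat O}(\mathbf p)=\mathrm{Tr}(\hat O\hat\rho(\mathbf p))$ and $F_{\hat\rho_{\rm f}}(\mathbf p)=\|\hat\rho(\mathbf p)-\hat\rho_{\rm f}\|^2$ (Hilbert–Schmidt norm). For $n=0$ these are exactly the control problems whose matrices $\hat K_{i,j},\hat\rho_0,\hat O,\hat\rho_{\rm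 f}$ have entries with rational real and imaginary parts. With $d=1$ the class contains the control of $n$-mode coherent light by unit displacements with $\hat O=-G(a_1,\dots,a_n)^\dagger G(a_1,\dots,a_n)$ for a nonconstant polynomial $G$ with integer coefficients. **Theorem.** 1. No algorithm, given the finite description of an arbitrary such expectation maximization problem, decides whether some accessible policy achieves $J_{\hat O}(\mathbf p)=0$. This holds even if the algorithm need only be correct, and need only halt, on those problems for which $J_{\hat O}(\mathbf p)$ is a non-positive integer for every $\mathbf p\in AP$. 2. No algorithm, given an arbitrary such state preparation problem, decides whether some accessible policy achieves $\hat\rho(\mathbf p)=\hat\rho_{\rm f}$. 3. Let $0<\varepsilon<1$ be any fixed real number. No algorithm decides whether some accessible policy achieves $-\varepsilon\le J_{\hat O}(\mathbf p)\le 0$, again even if it need only be correct, and need only halt, on the problems for which $J_{\hat O}$ takes only non-positive integer values on $AP$. No algorithm decides whether some accessible policy achieves $F_{\hat\rho_{\rm f}}(\mathbf p)<\varepsilon$. In every case an algorithm means a partial recursive (Turing computable) procedure acting on the finite descriptions, required to answer correctly only on descriptions of problems as above. -/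

import Mathlib

noncomputable section

namespace QControl

open scoped ComplexOrder

/-! ### Finite descriptions (the input of an algorithm)

All data are rational.  A finite description is a tuple of natural numbers, integers and
lists of such, so that it can be handed to a Turing machine.  In every list that is indexed by
the modes, missing entries count as zero and superfluous ones are ignored. -/

/-- The pair `(z, k)` describes the rational number `z / (k + 1)`. -/
abbrev RatCode : Type := ℤ × ℕ

/-- The real and the imaginary part of a Gaussian rational number. -/
abbrev GaussCode : Type := RatCode × RatCode

/-- Describes the displaced number vector `|level⟩ ⊗ ⨂_l D(disp l) |occ l⟩`. -/
structure KetCode where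
  level : ℕ
  occ : List ℕ
  disp : List GaussCode

/-- Describes the rank-one operator `coef • |ket⟩⟨bra|`. -/
structure DyadCode where
  coef : GaussCode
  ket : KetCode
  bra : KetCode

/-- Describes the bounded operator
`coef • |row⟩⟨col| ⊗ ⨂_l D(disp l) S^(up l) (S†)^(down l)`,
where `S |k⟩ = |k + 1⟩` is the shift between neighbouring levels. -/
structure KrausTerm where
  coef : GaussCode
  row : ℕ
  col : ℕ
  disp : List GaussCode
  up : List ℕ
  down : List ℕ

/-- Describes the normally ordered monomial
`coef • |row⟩⟨col| ⊗ ⨂_l (a_l†)^(create l) (a_l)^(annihilate l)`. -/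
structure MonomialCode where
  coef : GaussCode
  row : ℕ
  col : ℕ
  create : List ℕ
  annihilate : List ℕ

/-- A Kraus operator: a finite sum of terms. -/
abbrev KrausCode : Type := List KrausTerm

/-- A control: the finite list of the Kraus operators of the corresponding Kraus map. -/
abbrev ControlCode : Type := List KrausCode

/-- A finite-rank operator: a finite sum of rank-one operators. -/
abbrev StateCode : Type := List DyadCode

/-- An observable: a polynomial in the creation and annihilation operators with matrix
coefficients, plus a finite-rank operator. -/
structure ObservableCode where
  poly : List MonomialCode
  finiteRank : StateCode

/-- A controlled system: a `levels`-level system together with `modes` modes, the initial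
density matrix, the finitely many controls, and the set of accessible policies, which is either
the set of all finite policies (`none`) or an explicitly listed finite set. -/
structure SystemCode where
  levels : ℕ
  modes : ℕ
  initial : StateCode
  controls : List ControlCode
  accessible : Option (List (List ℕ))

/-- Input of the problem of maximizing the expectation value of an observable. -/
structure ExpectationProblem where
  system : SystemCode
  observable : ObservableCode

/-- Input of the problem of preparing a target density matrix. -/
structure PreparationProblem where
  system : SystemCode
  target : StateCode

instance : Primcodable KetCode :=
  Primcodable.ofEquiv (ℕ × List ℕ × List GaussCode)
    ⟨fun s => (s.level, s.occ, s.disp), fun t => ⟨t.1, t.2.1, t.2.2⟩, fun _ => rfl, fun _ => rfl⟩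

instance : Primcodable DyadCode :=
  Primcodable.ofEquiv (GaussCode × KetCode × KetCode)
    ⟨fun s => (s.coef, s.ket, s.bra), fun t => ⟨t.1, t.2.1, t.2.2⟩, fun _ => rfl, fun _ => rfl⟩

instance : Primcodable KrausTerm :=
  Primcodable.ofEquiv (GaussCode × ℕ × ℕ × List GaussCode × List ℕ × List ℕ)
    ⟨fun s => (s.coef, s.row, s.col, s.disp, s.up, s.down),
      fun t => ⟨t.1, t.2.1, t.2.2.1, t.2.2.2.1, t.2.2.2.2.1, t.2.2.2.2.2⟩,
      fun _ => rfl, fun _ => rfl⟩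

instance : Primcodable MonomialCode :=
  Primcodable.ofEquiv (GaussCode × ℕ × ℕ × List ℕ × List ℕ)
    ⟨fun s => (s.coef, s.row, s.col, s.create, s.annihilate),
      fun t => ⟨t.1, t.2.1, t.2.2.1, t.2.2.2.1, t.2.2.2.2⟩, fun _ => rfl, fun _ => rfl⟩

instance : Primcodable ObservableCode :=
  Primcodable.ofEquiv (List MonomialCode × StateCode)
    ⟨fun s => (s.poly, s.finiteRank), fun t => ⟨t.1, t.2⟩, fun _ => rfl, fun _ => rfl⟩

instance : Primcodable SystemCode :=
  Primcodable.ofEquiv (ℕ × ℕ × StateCode × List ControlCode × Option (List (List ℕ)))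
    ⟨fun s => (s.levels, s.modes, s.initial, s.controls, s.accessible),
      fun t => ⟨t.1, t.2.1, t.2.2.1, t.2.2.2.1, t.2.2.2.2⟩, fun _ => rfl, fun _ => rfl⟩

instance : Primcodable ExpectationProblem :=
  Primcodable.ofEquiv (SystemCode × ObservableCode)
    ⟨fun s => (s.system, s.observable), fun t => ⟨t.1, t.2⟩, fun _ => rfl, fun _ => rfl⟩

instance : Primcodable PreparationProblem :=
  Primcodable.ofEquiv (SystemCode × StateCode)
    ⟨fun s => (s.system, s.target), fun t => ⟨t.1, t.2⟩, fun _ => rfl, fun _ => rfl⟩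

/-! ### The operators that are described

The Hilbert space is `ℂ^d ⊗ ℓ²(ℕ)^{⊗ n}`, and operators are written as their (infinite) matrices
in the orthonormal product basis of level states and number states. -/

/-- Labels of the orthonormal basis: a level and the occupation number of every mode. -/
abbrev Idx (d n : ℕ) : Type := Fin d × (Fin n → ℕ)

abbrev Op (d n : ℕ) : Type := Matrix (Idx d n) (Idx d n) ℂ

def RatCode.toRat (q : RatCode) : ℚ := (q.1 : ℚ) / ((q.2 : ℚ) + 1)

def GaussCode.toComplex (z : GaussCode) : ℂ :=
  ((RatCode.toRat z.1 : ℚ) : ℂ) + ((RatCode.toRat z.2 : ℚ) : ℂ) * Complex.I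

/-- Entry `l` of a list of amplitudes. -/
def amplitude (L : List GaussCode) (l : ℕ) : ℂ := GaussCode.toComplex (L.getD l ((0, 0), (0, 0)))

/-- The matrix element `⟨m| D(α) |k⟩` in the number basis of the displacement operator
`D(α) = exp(α a† - conj α a) = exp(-|α|² / 2) exp(α a†) exp(-conj α a)` of one mode. -/
def displacementElem (α : ℂ) (m k : ℕ) : ℂ :=
  (Real.exp (-(‖α‖ ^ 2) / 2) : ℂ) *
    ∑ j ∈ Finset.range (min m k + 1),
      ((Real.sqrt (m.factorial * k.factorial) /
          (j.factorial * (m - j).factorial * (k - j).factorial) : ℝ) : ℂ) *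
        α ^ (m - j) * (-(starRingEnd ℂ α)) ^ (k - j)

/-- The matrix element `⟨m| D(α) S^u (S†)^v |k⟩` of one mode. -/
def shiftElem (α : ℂ) (u v m k : ℕ) : ℂ :=
  if v ≤ k then displacementElem α m (k - v + u) else 0

/-- The matrix element `⟨m| (a†)^u a^v |k⟩` of one mode. -/
def ladderElem (u v m k : ℕ) : ℂ :=
  if m + v = k + u then
    ((Real.sqrt (k.descFactorial v) * Real.sqrt (m.descFactorial u) : ℝ) : ℂ)
  else 0

variable {d n : ℕ}

def KetCode.toVec (d n : ℕ) (v : KetCode) (x : Idx d n) : ℂ :=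
  if (x.1 : ℕ) = v.level then
    ∏ l : Fin n, displacementElem (amplitude v.disp l) (x.2 l) (v.occ.getD l 0)
  else 0

def StateCode.toOp (d n : ℕ) (s : StateCode) : Op d n := fun x y =>
  (s.map fun t => GaussCode.toComplex t.coef * t.ket.toVec d n x *
    starRingEnd ℂ (t.bra.toVec d n y)).sum

def KrausTerm.toOp (d n : ℕ) (t : KrausTerm) : Op d n := fun x y =>
  if (x.1 : ℕ) = t.row ∧ (y.1 : ℕ) = t.col then
    GaussCode.toComplex t.coef *
      ∏ l : Fin n, shiftElem (amplitude t.disp l) (t.up.getD l 0) (t.down.getD l 0) (x.2 l) (y.2 l)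
  else 0

def KrausCode.toOp (d n : ℕ) (K : KrausCode) : Op d n := fun x y =>
  (K.map fun t => t.toOp d n x y).sum

def MonomialCode.toOp (d n : ℕ) (t : MonomialCode) : Op d n := fun x y =>
  if (x.1 : ℕ) = t.row ∧ (y.1 : ℕ) = t.col then
    GaussCode.toComplex t.coef *
      ∏ l : Fin n, ladderElem (t.create.getD l 0) (t.annihilate.getD l 0) (x.2 l) (y.2 l)
  else 0

def ObservableCode.toOp (d n : ℕ) (o : ObservableCode) : Op d n := fun x y =>
  (o.poly.map fun t => t.toOp d n x y).sum + StateCode.toOp d n o.finiteRank x y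

/-- A density matrix: positive semidefinite (in particular Hermitian) with trace one. -/
def IsDensity (ρ : Op d n) : Prop := ρ.PosSemidef ∧ HasSum (fun x => ρ x x) 1

/-- The condition `∑_j K_j† K_j = 1` on the Kraus operators of a Kraus map. -/
def IsKrausFamily (d n : ℕ) (c : ControlCode) : Prop :=
  ∀ u v : Idx d n,
    (c.map fun K => ∑' x : Idx d n,
      starRingEnd ℂ (KrausCode.toOp d n K x u) * KrausCode.toOp d n K x v).sum =
    if u = v then 1 else 0

/-- The Kraus map `Φ[ρ] = ∑_j K_j ρ K_j†`. -/
def ControlCode.apply (c : ControlCode) (ρ : Op d n) : Op d n := fun x y =>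
  (c.map fun K => ∑' q : Idx d n × Idx d n,
    KrausCode.toOp d n K x q.1 * ρ q.1 q.2 * starRingEnd ℂ (KrausCode.toOp d n K y q.2)).sum

/-- `Tr (A ρ)`. -/
def traceMul (A ρ : Op d n) : ℂ := ∑' q : Idx d n × Idx d n, A q.1 q.2 * ρ q.2 q.1

/-- The square of the Hilbert-Schmidt distance. -/
def hsDistSq (ρ σ : Op d n) : ℝ := ∑' q : Idx d n × Idx d n, ‖ρ q.1 q.2 - σ q.1 q.2‖ ^ 2

/-- The values `⟨ψ, A ψ⟩`, for the unit vectors `ψ` with finitely many nonzero coordinates. -/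
def quadraticFormValues (A : Op d n) : Set ℝ :=
  {r | ∃ ψ : Idx d n →₀ ℂ, (ψ.sum fun _ z => ‖z‖ ^ 2) = 1 ∧
    r = (ψ.sum fun x z => ψ.sum fun y w => starRingEnd ℂ z * A x y * w).re}

/-- An observable, normalized so that the maximum of its expectation values is zero. -/
def IsNormalizedObservable (A : Op d n) : Prop :=
  A.IsHermitian ∧ IsLUB (quadraticFormValues A) 0

/-! ### Digitized quantum control -/

namespace SystemCode

variable (S : SystemCode)

/-- The description is meaningful: an initial density matrix and Kraus maps. -/
def Valid : Prop :=
  IsDensity (StateCode.toOp S.levels S.modes S.initial) ∧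
    ∀ c ∈ S.controls, IsKrausFamily S.levels S.modes c

/-- The accessible policies `p = (p_1, …, p_P)`, each `p_k` being the number of a control. -/
def Accessible (p : List ℕ) : Prop :=
  (∀ i ∈ p, i < S.controls.length) ∧ ∀ L, S.accessible = some L → p ∈ L

/-- The propagated state `ρ(p) = Φ_{p_P} ⋯ Φ_{p_1} [ρ₀]`. -/
def propagate (p : List ℕ) : Op S.levels S.modes :=
  p.foldl (fun ρ i => ControlCode.apply (S.controls.getD i []) ρ)
    (StateCode.toOp S.levels S.modes S.initial)

end SystemCode

namespace ExpectationProblem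

variable (Q : ExpectationProblem)

def Valid : Prop :=
  Q.system.Valid ∧
    IsNormalizedObservable (Q.observable.toOp Q.system.levels Q.system.modes)

/-- The objective `J(p) = Tr (O ρ(p))`. -/
def objective (p : List ℕ) : ℝ :=
  (traceMul (Q.observable.toOp Q.system.levels Q.system.modes) (Q.system.propagate p)).re

/-- Along all accessible policies the objective takes only non-positive integer values. -/
def IntegerValued : Prop :=
  ∀ p, Q.system.Accessible p → ∃ k : ℕ, Q.objective p = -(k : ℝ)

/-- Some accessible policy attains the optimum. -/
def Solvable : Prop := ∃ p, Q.system.Accessible p ∧ Q.objective p = 0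

/-- Some accessible policy is optimal with accuracy `ε`. -/
def ApproxSolvable (ε : ℝ) : Prop :=
  ∃ p, Q.system.Accessible p ∧ -ε ≤ Q.objective p ∧ Q.objective p ≤ 0

end ExpectationProblem

namespace PreparationProblem

variable (Q : PreparationProblem)

def targetOp : Op Q.system.levels Q.system.modes :=
  StateCode.toOp Q.system.levels Q.system.modes Q.target

def Valid : Prop := Q.system.Valid ∧ IsDensity Q.targetOp

/-- The objective `F(p) = ‖ρ(p) - ρ_f‖²`. -/
def objective (p : List ℕ) : ℝ := hsDistSq (Q.system.propagate p) Q.targetOp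

/-- Some accessible policy prepares the target state. -/
def Solvable : Prop := ∃ p, Q.system.Accessible p ∧ Q.system.propagate p = Q.targetOp

/-- Some accessible policy prepares the target state with accuracy `ε`. -/
def ApproxSolvable (ε : ℝ) : Prop := ∃ p, Q.system.Accessible p ∧ Q.objective p < ε

end PreparationProblem

/-- Some algorithm answers the question `yes` correctly on every instance that satisfies `inst`
(on other inputs it may answer anything, or not halt). -/
def AlgorithmicallyDecidable {α : Type} [Primcodable α] (inst yes : α → Prop) : Prop :=
  ∃ f : α →. Bool, Partrec f ∧ ∀ a, inst a → ∃ b ∈ f a, (b = true ↔ yes a)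

end QControl

end

/-!
The control problems contain a universal model of computation, so that the halting problem reduces
to them. One level and finitely many modes suffice, and all displacements can be trivial.

A number state of the modes is a marking of a Petri net, with the occupation numbers as numbers of
tokens. A transition of the net takes tokens from some places, puts tokens into some places and may
also require that one place holds no further tokens. The product of shifts
`⨂_l S^(u l) (S†)^(v l)` takes `v` and makes `u`, and annihilates the markings without enough
tokens. The difference of two such products realizes the additional test, and together with the
projection onto the markings where the transition is blocked it forms a Kraus map
(`isKrausFamily_ruleControl`), which maps number states to number states (`apply_ruleControl`).
A policy is therefore a sequence of transitions to be tried, and a marking is reachable if and only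
if some policy prepares the corresponding number state. The goal is the empty marking, that is, the
vacuum; it is selected by the observable `|0⟩⟨0| - 1`, with values `0` and `-1` on number
states, and by the target state `|0⟩⟨0|`, at squared distance `2` from every other number state.
So exact and approximate solvability coincide for an accuracy below one.

Nets with such tests simulate nondeterministic counter programs, the regular expressions over the
actions of incrementing, decrementing and testing a register. The control states are the lists of
the programs that remain to be executed; a program uses finitely many of them, and each becomes a
place holding at most one token (`CounterProgram.reaches_zero_iff`).

Since the programs are nondeterministic, they need not compute anything: it is enough to check
relations, because intermediate results can be guessed. The checkable relations contain equality and
successor, and they are closed under conjunction, disjunction, existential quantification and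
iteration of a step relation (`CounterProgram.Checkable.iter`). Addition, multiplication, the
pairing function and finally the graphs of all partial recursive functions
(`CounterProgram.Enumerable.graph`) are obtained in this way.

Applied to one partial recursive function with undecidable domain, this gives a fixed net. Only the
number of tokens in its first place depends on the instance, hence the map from instances to control
problems is evidently computable.
-/

/-! ### Nondeterministic counter programs -/

namespace CounterProgram

open Function Relation

/-- The elementary actions on a store of natural-number registers; `dec` and `zero` block when
the register is zero, respectively positive. -/
inductive Action
  | nop
  | inc (r : ℕ)
  | dec (r : ℕ)
  | zero (r : ℕ)

/-- The effect of an action, as a relation between the stores before and after it. -/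
def Action.Rel : Action → (ℕ → ℕ) → (ℕ → ℕ) → Prop
  | nop, s, t => t = s
  | inc r, s, t => t = update s r (s r + 1)
  | dec r, s, t => 0 < s r ∧ t = update s r (s r - 1)
  | zero r, s, t => s r = 0 ∧ t = s

/-- Nondeterministic programs: the regular expressions over the elementary actions. -/
inductive Prog
  | act (a : Action)
  | seq (p q : Prog)
  | alt (p q : Prog)
  | star (p : Prog)

/-- `p.Rel s t` says that some run of `p` leads from the store `s` to the store `t`. -/
def Prog.Rel : Prog → (ℕ → ℕ) → (ℕ → ℕ) → Prop
  | act a => a.Rel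
  | seq p q => Relation.Comp p.Rel q.Rel
  | alt p q => fun s t => p.Rel s t ∨ q.Rel s t
  | star p => ReflTransGen p.Rel

namespace Prog

def inc (r : ℕ) : Prog := act (.inc r)
def dec (r : ℕ) : Prog := act (.dec r)
def zero (r : ℕ) : Prog := act (.zero r)

/-- Gives the register `r` an arbitrary new value. -/
def havoc (r : ℕ) : Prog := seq (star (inc r)) (star (dec r))

/-- Sets the register `r` to zero: the value has to be guessed correctly. -/
def clear (r : ℕ) : Prog := seq (havoc r) (zero r)

theorem rel_star_inc (s : ℕ → ℕ) (r k : ℕ) :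
    (star (inc r)).Rel s (update s r (s r + k)) := by
  induction k with
  | zero => rw [add_zero, update_eq_self]; exact ReflTransGen.refl
  | succ k ih =>
    refine ih.tail ?_
    simp [inc, Rel, Action.Rel, add_assoc]

theorem rel_star_dec (s : ℕ → ℕ) (r y k : ℕ) :
    (star (dec r)).Rel (update s r (y + k)) (update s r y) := by
  induction k with
  | zero => exact ReflTransGen.refl
  | succ k ih =>
    refine ReflTransGen.head ?_ ih
    simp [dec, Rel, Action.Rel, ← add_assoc]

theorem rel_havoc {r : ℕ} {s t : ℕ → ℕ} : (havoc r).Rel s t ↔ ∃ y, t = update s r y := by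
  constructor
  · rintro ⟨m, h₁, h₂⟩
    have key : ∃ y, m = update s r y := by
      refine ReflTransGen.head_induction_on (motive := fun s _ => ∃ y, m = update s r y) h₁
        ⟨m r, by simp⟩ ?_
      rintro a c h - ⟨y, rfl⟩
      obtain rfl : c = _ := h
      exact ⟨y, by simp⟩
    obtain ⟨y, rfl⟩ := key
    refine ReflTransGen.head_induction_on
      (motive := fun a _ => (∃ y, a = update s r y) → ∃ y, t = update s r y) h₂
      (fun h => h) ?_ ⟨y, rfl⟩
    rintro a c ⟨-, rfl⟩ - ih ⟨y, rfl⟩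
    exact ih ⟨_, by simp only [update_idem]; rfl⟩
  · rintro ⟨y, rfl⟩
    refine ⟨update s r (s r + y), rel_star_inc s r y, ?_⟩
    rw [add_comm]
    exact rel_star_dec s r y (s r)

theorem rel_clear {r : ℕ} {s t : ℕ → ℕ} : (clear r).Rel s t ↔ t = update s r 0 := by
  constructor
  · rintro ⟨m, h₁, h₂⟩
    obtain ⟨y, rfl⟩ := rel_havoc.1 h₁
    obtain ⟨h, rfl⟩ : _ ∧ _ := h₂
    simp only [update_self] at h
    rw [h]
  · rintro rfl
    exact ⟨_, rel_havoc.2 ⟨0, rfl⟩, by simp [zero, Rel, Action.Rel]⟩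

end Prog

/-! ### Relations that programs can check -/

/-- The program `p` checks the condition `R`: when started in a store whose registers from `w` on are
zero, it can terminate exactly if `R` holds, and then it restores the store. -/
def Checks (w : ℕ) (p : Prog) (R : (ℕ → ℕ) → Prop) : Prop :=
  ∀ s, (∀ r, w ≤ r → s r = 0) → ∀ t, p.Rel s t ↔ t = s ∧ R s

def Checkable (w : ℕ) (R : (ℕ → ℕ) → Prop) : Prop := ∃ p, Checks w p R

theorem checkable_true (w : ℕ) : Checkable w fun _ => True := by
  refine ⟨.act .nop, fun s _ t => ?_⟩
  simp [Prog.Rel, Action.Rel]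

theorem checkable_false (w : ℕ) : Checkable w fun _ => False := by
  refine ⟨.seq (.inc 0) (.zero 0), fun s _ t => ?_⟩
  simp only [and_false, iff_false]
  rintro ⟨m, h₁, h₂⟩
  obtain rfl : m = _ := h₁
  simpa using h₂.1

theorem checkable_zero (w a : ℕ) : Checkable w fun s => s a = 0 :=
  ⟨.zero a, fun _ _ _ => and_comm⟩

theorem Checkable.and {w : ℕ} {R R' : (ℕ → ℕ) → Prop} (h : Checkable w R) (h' : Checkable w R') :
    Checkable w fun s => R s ∧ R' s := by
  obtain ⟨p, hp⟩ := h
  obtain ⟨q, hq⟩ := h'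
  refine ⟨.seq p q, fun s hs t => ⟨?_, ?_⟩⟩
  · rintro ⟨m, h₁, h₂⟩
    obtain ⟨rfl, h₁⟩ := (hp s hs m).1 h₁
    obtain ⟨rfl, h₂⟩ := (hq m hs t).1 h₂
    exact ⟨rfl, h₁, h₂⟩
  · rintro ⟨rfl, h₁, h₂⟩
    exact ⟨t, (hp t hs t).2 ⟨rfl, h₁⟩, (hq t hs t).2 ⟨rfl, h₂⟩⟩

theorem Checkable.or {w : ℕ} {R R' : (ℕ → ℕ) → Prop} (h : Checkable w R) (h' : Checkable w R') :
    Checkable w fun s => R s ∨ R' s := by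
  obtain ⟨p, hp⟩ := h
  obtain ⟨q, hq⟩ := h'
  refine ⟨.alt p q, fun s hs t => ?_⟩
  have h₁ := hp s hs t
  have h₂ := hq s hs t
  simp only [Prog.Rel, h₁, h₂]
  tauto

/-- Three registers of a store are set to given values. -/
def set₃ (s : ℕ → ℕ) (a b w i j k : ℕ) : ℕ → ℕ := update (update (update s a i) b j) w k

theorem set₃_rel_down {s t : ℕ → ℕ} {a b w : ℕ} (hab : a ≠ b) (ha : a ≠ w) (hb : b ≠ w)
    (i j k : ℕ) :
    (Prog.seq (.dec a) (.seq (.dec b) (.inc w))).Rel (set₃ s a b w i j k) t ↔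
      0 < i ∧ 0 < j ∧ t = set₃ s a b w (i - 1) (j - 1) (k + 1) := by
  simp only [Prog.Rel, Relation.Comp, Prog.dec, Prog.inc, Action.Rel, set₃]
  constructor
  · rintro ⟨_, ⟨h₁, rfl⟩, _, ⟨h₂, rfl⟩, rfl⟩
    simp only [update_self, update_of_ne ha, update_of_ne hb, update_of_ne hab,
      update_of_ne hab.symm] at h₁ h₂ ⊢
    refine ⟨h₁, h₂, ?_⟩
    ext x
    simp only [update_apply]
    split_ifs <;> grind
  · rintro ⟨h₁, h₂, rfl⟩
    refine ⟨_, ⟨?_, rfl⟩, _, ⟨?_, rfl⟩, ?_⟩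
    · simpa [ha, hab]
    · simpa [hb, hab.symm]
    · ext x
      simp only [update_apply]
      split_ifs <;> grind

theorem set₃_rel_up {s t : ℕ → ℕ} {a b w : ℕ} (hab : a ≠ b) (ha : a ≠ w) (hb : b ≠ w)
    (i j k : ℕ) :
    (Prog.seq (.dec w) (.seq (.inc a) (.inc b))).Rel (set₃ s a b w i j k) t ↔
      0 < k ∧ t = set₃ s a b w (i + 1) (j + 1) (k - 1) := by
  simp only [Prog.Rel, Relation.Comp, Prog.dec, Prog.inc, Action.Rel, set₃]
  constructor
  · rintro ⟨_, ⟨h₁, rfl⟩, _, rfl, rfl⟩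
    simp only [update_self] at h₁
    refine ⟨h₁, ?_⟩
    ext x
    simp only [update_apply]
    split_ifs <;> grind
  · rintro ⟨h₁, rfl⟩
    refine ⟨_, ⟨?_, rfl⟩, _, rfl, ?_⟩
    · simpa
    · ext x
      simp only [update_apply]
      split_ifs <;> grind

theorem set₃_eta {s : ℕ → ℕ} {a b w : ℕ} : set₃ s a b w (s a) (s b) (s w) = s := by
  simp [set₃]

/-- Equality is checked by moving the common part of two registers to a scratch register and
back. -/
theorem checkable_eq {w a b : ℕ} (ha : a < w) (hb : b < w) : Checkable w fun s => s a = s b := by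
  by_cases hab : a = b
  · subst hab; simpa using checkable_true w
  have ha' := ha.ne
  have hb' := hb.ne
  refine ⟨.seq (.star (.seq (.dec a) (.seq (.dec b) (.inc w)))) (.seq (.zero a) (.seq (.zero b)
    (.seq (.star (.seq (.dec w) (.seq (.inc a) (.inc b)))) (.zero w)))), fun s hs t => ⟨?_, ?_⟩⟩
  · rintro ⟨m, h₁, _, ⟨hma, rfl⟩, m₁, ⟨hmb, hm₁⟩, m₂, h₂, hmw, hm₂⟩
    subst hm₁ hm₂
    have down : ∀ i j k, ReflTransGen (Prog.seq (.dec a) (.seq (.dec b) (.inc w))).Rel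
        (set₃ s a b w i j k) m₁ → ∃ e ≤ i, e ≤ j ∧ m₁ = set₃ s a b w (i - e) (j - e) (k + e) := by
      intro i j k h
      generalize hx : set₃ s a b w i j k = x at h
      induction h using ReflTransGen.head_induction_on generalizing i j k with
      | refl => exact ⟨0, by simp, by simp, by simp [hx]⟩
      | head h _ ih =>
        subst hx
        obtain ⟨hi, hj, rfl⟩ := (set₃_rel_down hab ha' hb' _ _ _).1 h
        obtain ⟨e, he, he', rfl⟩ := ih _ _ _ rfl
        refine ⟨e + 1, by omega, by omega, ?_⟩
        congr 1 <;> omega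
    have up : ∀ i j k, ReflTransGen (Prog.seq (.dec w) (.seq (.inc a) (.inc b))).Rel
        (set₃ s a b w i j k) t → ∃ e ≤ k, t = set₃ s a b w (i + e) (j + e) (k - e) := by
      intro i j k h
      generalize hx : set₃ s a b w i j k = x at h
      induction h using ReflTransGen.head_induction_on generalizing i j k with
      | refl => exact ⟨0, by simp, by simp [hx]⟩
      | head h _ ih =>
        subst hx
        obtain ⟨hk, rfl⟩ := (set₃_rel_up hab ha' hb' _ _ _).1 h
        obtain ⟨e, he, rfl⟩ := ih _ _ _ rfl
        refine ⟨e + 1, by omega, ?_⟩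
        congr 1 <;> omega
    obtain ⟨e, he, he', rfl⟩ := down (s a) (s b) (s w) (by rw [set₃_eta]; exact h₁)
    obtain ⟨e', hw, rfl⟩ := up _ _ _ h₂
    have h0 := hs w le_rfl
    simp only [set₃, update_self, update_of_ne ha', update_of_ne hb',
      update_of_ne hab] at hma hmb hmw
    refine ⟨?_, by omega⟩
    conv_rhs => rw [← set₃_eta (s := s) (a := a) (b := b) (w := w)]
    congr 1 <;> omega
  · rintro ⟨rfl, h⟩
    have h0 := hs w le_rfl
    have down : ∀ e i j k, ReflTransGen (Prog.seq (.dec a) (.seq (.dec b) (.inc w))).Rel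
        (set₃ t a b w (i + e) (j + e) k) (set₃ t a b w i j (k + e)) := by
      intro e
      induction e with
      | zero => intros; exact .refl
      | succ e ih =>
        intro i j k
        refine .head ((set₃_rel_down hab ha' hb' _ _ _).2 ⟨by omega, by omega, rfl⟩) ?_
        convert ih i j (k + 1) using 2 <;> omega
    have up : ∀ e i j k, ReflTransGen (Prog.seq (.dec w) (.seq (.inc a) (.inc b))).Rel
        (set₃ t a b w i j (k + e)) (set₃ t a b w (i + e) (j + e) k) := by
      intro e
      induction e with
      | zero => intros; exact .refl
      | succ e ih =>
        intro i j k
        refine .head ((set₃_rel_up hab ha' hb' _ _ _).2 ⟨by omega, rfl⟩) ?_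
        convert ih (i + 1) (j + 1) k using 2 <;> omega
    have ht : set₃ t a b w (t a) (t a) 0 = t := by
      conv_rhs => rw [← set₃_eta (s := t) (a := a) (b := b) (w := w)]
      rw [← h, h0]
    refine ⟨set₃ t a b w 0 0 (t a), ?_, _, ⟨?_, rfl⟩, _, ⟨?_, rfl⟩, t, ?_, ?_⟩
    · have := down (t a) 0 0 0
      simp only [zero_add, ht] at this
      exact this
    · simp [set₃, ha', hab]
    · simp [set₃, hb']
    · have := up (t a) 0 0 0
      simp only [zero_add, ht] at this
      exact this
    · exact ⟨h0, rfl⟩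

/-- The larger register is decremented for the duration of an equality check. -/
theorem checkable_succ {w a b : ℕ} (ha : a < w) (hb : b < w) :
    Checkable w fun s => s b = s a + 1 := by
  by_cases hab : a = b
  · subst hab; simpa using checkable_false w
  obtain ⟨p, hp⟩ := checkable_eq ha hb
  have hz : ∀ {s : ℕ → ℕ}, (∀ r, w ≤ r → s r = 0) → ∀ y r, w ≤ r → update s b y r = 0 := by
    intro s hs y r hr
    rw [update_of_ne (by omega), hs r hr]
  refine ⟨.seq (.dec b) (.seq p (.inc b)), fun s hs t => ⟨?_, ?_⟩⟩
  · rintro ⟨_, ⟨h, rfl⟩, _, h₁, h₂⟩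
    obtain ⟨rfl, h₃⟩ := (hp _ (hz hs _) _).1 h₁
    obtain rfl : t = _ := h₂
    simp only [update_self, update_of_ne hab] at h₃
    refine ⟨?_, by omega⟩
    simp [Nat.sub_add_cancel h]
  · rintro ⟨rfl, h⟩
    refine ⟨_, ⟨by omega, rfl⟩, _, (hp _ (hz hs _) _).2 ⟨rfl, ?_⟩, ?_⟩
    · simp [update_of_ne hab, h]
    · have h' : 0 < t b := by omega
      simp [Prog.inc, Prog.Rel, Action.Rel, Nat.sub_add_cancel h']

/-- Register `w` serves to guess a witness. -/
theorem Checkable.ex {w : ℕ} {R : (ℕ → ℕ) → Prop} (h : Checkable (w + 1) R) :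
    Checkable w fun s => ∃ y, R (update s w y) := by
  obtain ⟨p, hp⟩ := h
  have hz : ∀ {s : ℕ → ℕ}, (∀ r, w ≤ r → s r = 0) → ∀ y r, w + 1 ≤ r → update s w y r = 0 := by
    intro s hs y r hr
    rw [update_of_ne (by omega), hs r (by omega)]
  refine ⟨.seq (.havoc w) (.seq p (.clear w)), fun s hs t => ⟨?_, ?_⟩⟩
  · rintro ⟨m, h₁, m', h₂, h₃⟩
    obtain ⟨y, rfl⟩ := Prog.rel_havoc.1 h₁
    obtain ⟨rfl, h₄⟩ := (hp _ (hz hs y) _).1 h₂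
    obtain rfl := Prog.rel_clear.1 h₃
    refine ⟨?_, y, h₄⟩
    rw [update_idem, ← hs w le_rfl, update_eq_self]
  · rintro ⟨rfl, y, h⟩
    refine ⟨_, Prog.rel_havoc.2 ⟨y, rfl⟩, _, (hp _ (hz hs y) _).2 ⟨rfl, h⟩, Prog.rel_clear.2 ?_⟩
    rw [update_idem, ← hs w le_rfl, update_eq_self]

/-- The values that can be reached in `n` steps, starting from a value in `I`, where step number
`i` may lead from `a` to `b` if `T i a b` holds. -/
def IterRel (I : ℕ → Prop) (T : ℕ → ℕ → ℕ → Prop) : ℕ → ℕ → Prop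
  | 0, b => I b
  | n + 1, b => ∃ a, IterRel I T n a ∧ T n a b

/-- Iteration is checked by guessing the successive values: register `w` counts the steps, `w + 1`
holds the current value and `w + 2` the next one. -/
theorem Checkable.iter {w c d : ℕ} (hc : c < w) (hd : d < w) {I : ℕ → (ℕ → ℕ) → Prop}
    {T : ℕ → ℕ → ℕ → (ℕ → ℕ) → Prop}
    (hI₀ : ∀ i s t, (∀ r < w, s r = t r) → (I i s ↔ I i t))
    (hT₀ : ∀ i a b s t, (∀ r < w, s r = t r) → (T i a b s ↔ T i a b t))
    (hI : Checkable (w + 3) fun s => I (s (w + 1)) s)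
    (hT : Checkable (w + 3) fun s => T (s w) (s (w + 1)) (s (w + 2)) s) :
    Checkable w fun s => IterRel (I · s) (T · · · s) (s c) (s d) := by
  obtain ⟨p, hp⟩ := hI
  obtain ⟨q, hq⟩ := hT
  obtain ⟨e₁, he₁⟩ := checkable_eq (w := w + 3) (a := w + 1) (b := w + 2) (by omega) (by omega)
  obtain ⟨e₂, he₂⟩ := (checkable_eq (w := w + 3) (a := w) (b := c) (by omega) (by omega)).and
    (checkable_eq (w := w + 3) (a := w + 1) (b := d) (by omega) (by omega))
  let body : Prog := .seq (.havoc (w + 2)) (.seq q (.seq (.havoc (w + 1)) (.seq e₁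
    (.seq (.clear (w + 2)) (.inc w)))))
  have hz : ∀ {s : ℕ → ℕ}, (∀ r, w ≤ r → s r = 0) → ∀ i j k r, w + 3 ≤ r →
      set₃ s w (w + 1) (w + 2) i j k r = 0 := by
    intro s hs i j k r hr
    simp only [set₃]
    rw [update_of_ne (by omega), update_of_ne (by omega), update_of_ne (by omega), hs r (by omega)]
  have hlt : ∀ (s : ℕ → ℕ) i j k, ∀ r < w, set₃ s w (w + 1) (w + 2) i j k r = s r := by
    intro s i j k r hr
    simp only [set₃]
    rw [update_of_ne (by omega), update_of_ne (by omega), update_of_ne (by omega)]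
  have g0 : ∀ (s : ℕ → ℕ) i j k, set₃ s w (w + 1) (w + 2) i j k w = i := by
    intros; simp [set₃]
  have g1 : ∀ (s : ℕ → ℕ) i j k, set₃ s w (w + 1) (w + 2) i j k (w + 1) = j := by
    intros; simp [set₃]
  have g2 : ∀ (s : ℕ → ℕ) i j k, set₃ s w (w + 1) (w + 2) i j k (w + 2) = k := by
    intros; simp [set₃]
  have u0 : ∀ (s : ℕ → ℕ) i j k y, update (set₃ s w (w + 1) (w + 2) i j k) w y =
      set₃ s w (w + 1) (w + 2) y j k := by
    intros; ext x; simp only [set₃, update_apply]; split_ifs <;> first | rfl | omega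
  have u1 : ∀ (s : ℕ → ℕ) i j k y, update (set₃ s w (w + 1) (w + 2) i j k) (w + 1) y =
      set₃ s w (w + 1) (w + 2) i y k := by
    intros; ext x; simp only [set₃, update_apply]; split_ifs <;> first | rfl | omega
  have u2 : ∀ (s : ℕ → ℕ) i j k y, update (set₃ s w (w + 1) (w + 2) i j k) (w + 2) y =
      set₃ s w (w + 1) (w + 2) i j y := by
    intros; ext x; simp only [set₃, update_apply]; split_ifs <;> rfl
  have hs3 : ∀ {s : ℕ → ℕ}, (∀ r, w ≤ r → s r = 0) → set₃ s w (w + 1) (w + 2) 0 0 0 = s := by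
    intro s hs
    conv_rhs => rw [← set₃_eta (s := s) (a := w) (b := w + 1) (w := w + 2)]
    rw [hs w (by omega), hs (w + 1) (by omega), hs (w + 2) (by omega)]
  have hbody : ∀ {s : ℕ → ℕ}, (∀ r, w ≤ r → s r = 0) → ∀ i a t,
      body.Rel (set₃ s w (w + 1) (w + 2) i a 0) t ↔
        ∃ b, T i a b s ∧ t = set₃ s w (w + 1) (w + 2) (i + 1) b 0 := by
    intro s hs i a t
    constructor
    · rintro ⟨_, h₁, _, h₂, _, h₃, _, h₄, _, h₅, h₆⟩
      obtain ⟨b, rfl⟩ := Prog.rel_havoc.1 h₁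
      rw [u2] at h₂
      obtain ⟨rfl, hab⟩ := (hq _ (hz hs _ _ _) _).1 h₂
      obtain ⟨b', rfl⟩ := Prog.rel_havoc.1 h₃
      rw [u1] at h₄
      obtain ⟨rfl, hb⟩ := (he₁ _ (hz hs _ _ _) _).1 h₄
      rw [g1, g2] at hb
      subst hb
      obtain rfl := Prog.rel_clear.1 h₅
      obtain rfl : t = _ := h₆
      rw [g0, g1, g2, hT₀ _ _ _ _ _ (hlt s _ _ _)] at hab
      refine ⟨b', hab, ?_⟩
      rw [u2, g0, u0]
    · rintro ⟨b, h, rfl⟩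
      refine ⟨_, Prog.rel_havoc.2 ⟨b, rfl⟩, set₃ s w (w + 1) (w + 2) i a b, ?_, _,
        Prog.rel_havoc.2 ⟨b, rfl⟩, set₃ s w (w + 1) (w + 2) i b b, ?_, _,
        Prog.rel_clear.2 rfl, ?_⟩
      · rw [u2]
        refine (hq _ (hz hs _ _ _) _).2 ⟨rfl, ?_⟩
        beta_reduce
        rwa [g0, g1, g2, hT₀ _ _ _ _ _ (hlt s _ _ _)]
      · rw [u1]
        refine (he₁ _ (hz hs _ _ _) _).2 ⟨rfl, ?_⟩
        beta_reduce
        rw [g1, g2]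
      · rw [u2]
        change _ = _
        rw [g0, u0]
  refine ⟨.seq (.havoc (w + 1)) (.seq p (.seq (.star body) (.seq e₂ (.seq (.clear w)
    (.clear (w + 1)))))), fun s hs t => ⟨?_, ?_⟩⟩
  · rintro ⟨_, h₁, _, h₂, m, h₃, _, h₄, _, h₅, h₆⟩
    obtain ⟨b, rfl⟩ := Prog.rel_havoc.1 h₁
    rw [← hs3 hs, u1] at h₂
    obtain ⟨rfl, hb⟩ := (hp _ (hz hs _ _ _) _).1 h₂
    rw [g1, hI₀ _ _ _ (hlt s _ _ _)] at hb
    have key : ∃ i a, IterRel (I · s) (T · · · s) i a ∧ m = set₃ s w (w + 1) (w + 2) i a 0 := by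
      clear h₄
      change ReflTransGen _ _ _ at h₃
      induction h₃ with
      | refl => exact ⟨0, b, hb, rfl⟩
      | tail _ h ih =>
        obtain ⟨i, a, hia, rfl⟩ := ih
        obtain ⟨b, hb, rfl⟩ := (hbody hs _ _ _).1 h
        exact ⟨i + 1, b, ⟨a, hia, hb⟩, rfl⟩
    obtain ⟨i, a, hia, rfl⟩ := key
    obtain ⟨rfl, hcd⟩ := (he₂ _ (hz hs _ _ _) _).1 h₄
    rw [g0, g1, hlt _ _ _ _ _ hc, hlt _ _ _ _ _ hd] at hcd
    obtain rfl := Prog.rel_clear.1 h₅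
    obtain rfl := Prog.rel_clear.1 h₆
    rw [u0, u1, hs3 hs]
    obtain ⟨rfl, rfl⟩ := hcd
    exact ⟨rfl, hia⟩
  · rintro ⟨rfl, h⟩
    have key : ∀ i a, IterRel (I · t) (T · · · t) i a → ∃ b, I b t ∧
        ReflTransGen body.Rel (set₃ t w (w + 1) (w + 2) 0 b 0)
          (set₃ t w (w + 1) (w + 2) i a 0) := by
      intro i
      induction i with
      | zero => exact fun a h => ⟨a, h, .refl⟩
      | succ i ih =>
        rintro a ⟨a', h, h'⟩
        obtain ⟨b, hb, hr⟩ := ih a' h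
        exact ⟨b, hb, hr.tail ((hbody hs _ _ _).2 ⟨a, h', rfl⟩)⟩
    obtain ⟨b, hb, hr⟩ := key _ _ h
    refine ⟨set₃ t w (w + 1) (w + 2) 0 b 0, Prog.rel_havoc.2 ⟨b, ?_⟩, _, ?_, _, hr,
      set₃ t w (w + 1) (w + 2) (t c) (t d) 0, ?_, _,
      Prog.rel_clear.2 rfl, Prog.rel_clear.2 ?_⟩
    · conv_rhs => rw [← hs3 hs]
      rw [u1]
    · refine (hp _ (hz hs _ _ _) _).2 ⟨rfl, ?_⟩
      beta_reduce
      rwa [g1, hI₀ _ _ _ (hlt t _ _ _)]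
    · refine (he₂ _ (hz hs _ _ _) _).2 ⟨rfl, ?_⟩
      beta_reduce
      rw [g0, g1, hlt _ _ _ _ _ hc, hlt _ _ _ _ _ hd]
      exact ⟨rfl, rfl⟩
    · rw [u0, u1, hs3 hs]

end CounterProgram

/-! ### Recursively enumerable relations -/

namespace CounterProgram

open Function Relation

/-- The stream `y, x 0, x 1, …`. -/
def scons (y : ℕ) (x : ℕ → ℕ) : ℕ → ℕ
  | 0 => y
  | i + 1 => x i

/-- A condition on a stream of numbers (in practice on finitely many of its entries) that can be
checked by a counter program, wherever the entries are stored. The map `v` assigns registers to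
the entries. -/
def Enumerable (R : (ℕ → ℕ) → Prop) : Prop :=
  ∀ w (v : ℕ → ℕ), (∀ i, v i < w) → Checkable w fun s => R (s ∘ v)

namespace Enumerable

theorem zero (i : ℕ) : Enumerable fun x => x i = 0 :=
  fun w v _ => checkable_zero w (v i)

theorem eq (i j : ℕ) : Enumerable fun x => x i = x j :=
  fun _ _ hv => checkable_eq (hv i) (hv j)

theorem succ (i j : ℕ) : Enumerable fun x => x j = x i + 1 :=
  fun _ _ hv => checkable_succ (hv i) (hv j)

variable {R R' : (ℕ → ℕ) → Prop}

theorem and (h : Enumerable R) (h' : Enumerable R') : Enumerable fun x => R x ∧ R' x :=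
  fun w v hv => (h w v hv).and (h' w v hv)

theorem or (h : Enumerable R) (h' : Enumerable R') : Enumerable fun x => R x ∨ R' x :=
  fun w v hv => (h w v hv).or (h' w v hv)

theorem congr (h : Enumerable R) (h' : ∀ x, R' x ↔ R x) : Enumerable R' := by
  rwa [show R' = R from funext fun x => propext (h' x)]

theorem ex (h : Enumerable R) : Enumerable fun x => ∃ y, R (scons y x) := by
  intro w v hv
  have h₁ := (h (w + 1) (scons w v)
    (by rintro (_ | i); exacts [by simp [scons], (hv i).trans (by omega)])).ex
  have hv' : ∀ s y, update s w y ∘ scons w v = scons y (s ∘ v) := fun s y => ?_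
  · simpa only [hv'] using h₁
  funext i
  cases i with
  | zero => simp [scons]
  | succ i => simp [scons, update_of_ne (hv i).ne]

theorem iter {I : ℕ → (ℕ → ℕ) → Prop} {T : ℕ → ℕ → ℕ → (ℕ → ℕ) → Prop}
    (hI : Enumerable fun x => I (x 0) fun i => x (i + 1))
    (hT : Enumerable fun x => T (x 0) (x 1) (x 2) fun i => x (i + 3)) (i j : ℕ) :
    Enumerable fun x => IterRel (I · x) (T · · · x) (x i) (x j) := by
  intro w v hv
  refine Checkable.iter (I := fun i s => I i (s ∘ v)) (T := fun i a b s => T i a b (s ∘ v))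
    (hv i) (hv j) ?_ ?_ ?_ ?_
  · intro i s t h
    rw [show s ∘ v = t ∘ v from funext fun i => h _ (hv i)]
  · intro i a b s t h
    rw [show s ∘ v = t ∘ v from funext fun i => h _ (hv i)]
  · refine hI (w + 3) (scons (w + 1) v) ?_
    rintro (_ | i)
    exacts [by simp [scons], (hv i).trans (by omega)]
  · refine hT (w + 3) (scons w (scons (w + 1) (scons (w + 2) v))) ?_
    rintro (_ | _ | _ | i)
    exacts [by simp [scons], by simp [scons], by simp [scons], (hv i).trans (by omega)]

theorem add (i j k : ℕ) : Enumerable fun x => x k = x i + x j := by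
  refine (iter (I := fun b x => b = x i) (T := fun _ a b _ => b = a + 1)
    (eq 0 (i + 1)) (succ 1 2) j k).congr fun x => ?_
  have key : ∀ n b, IterRel (fun b => b = x i) (fun _ a b => b = a + 1) n b ↔ b = x i + n := by
    intro n
    induction n with
    | zero => simp [IterRel]
    | succ n ih => simp [IterRel, ih, add_assoc]
  exact (key _ _).symm

theorem mul (i j k : ℕ) : Enumerable fun x => x k = x i * x j := by
  refine (iter (I := fun b x => b = 0) (T := fun _ a b x => b = a + x i)
    (zero 0) (add 1 (i + 3) 2) j k).congr fun x => ?_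
  have key : ∀ n b, IterRel (fun b => b = 0) (fun _ a b => b = a + x i) n b ↔ b = x i * n := by
    intro n
    induction n with
    | zero => simp [IterRel]
    | succ n ih => simp [IterRel, ih, mul_add]
  exact (key _ _).symm

theorem le (i j : ℕ) : Enumerable fun x => x i ≤ x j :=
  (add (i + 1) 0 (j + 1)).ex.congr fun _ => le_iff_exists_add

theorem lt (i j : ℕ) : Enumerable fun x => x i < x j :=
  ((succ (i + 1) 0).and (le 0 (j + 1))).ex.congr fun x => by simp [scons]

theorem natPair (i j k : ℕ) : Enumerable fun x => x k = Nat.pair (x i) (x j) := by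
  refine (((lt i j).and ((mul (j + 1) (j + 1) 0).and (add 0 (i + 1) (k + 1))).ex).or
    ((le j i).and (((mul (i + 2) (i + 2) 1).and
      ((add 1 (i + 2) 0).and (add 0 (j + 2) (k + 2))))).ex.ex)).congr fun x => ?_
  simp only [scons, exists_eq_left]
  unfold Nat.pair
  split_ifs with h
  · simp [h]
  · simp [h, not_lt.1 h]

/-- The graph of every partial recursive function can be checked by a counter program. -/
theorem graph {f : ℕ →. ℕ} (hf : Nat.Partrec f) :
    ∀ i o : ℕ, Enumerable fun x => x o ∈ f (x i) := by
  induction hf with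
  | zero =>
    intro i o
    exact (zero o).congr fun x => by simp [pure, PFun.pure]
  | succ =>
    intro i o
    exact (succ i o).congr fun x => by simp
  | left =>
    intro i o
    refine (natPair (o + 1) 0 (i + 1)).ex.congr fun x => ?_
    simp only [scons, PFun.coe_val, Part.mem_some_iff]
    refine ⟨fun h => ⟨(x i).unpair.2, by rw [h, Nat.pair_unpair]⟩, ?_⟩
    rintro ⟨y, h⟩
    rw [h, Nat.unpair_pair]
  | right =>
    intro i o
    refine (natPair 0 (o + 1) (i + 1)).ex.congr fun x => ?_
    simp only [scons, PFun.coe_val, Part.mem_some_iff]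
    refine ⟨fun h => ⟨(x i).unpair.1, by rw [h, Nat.pair_unpair]⟩, ?_⟩
    rintro ⟨y, h⟩
    rw [h, Nat.unpair_pair]
  | pair _ _ hf hg =>
    intro i o
    refine ((hf (i + 2) 1).and ((hg (i + 2) 0).and (natPair 1 0 (o + 2)))).ex.ex.congr fun x => ?_
    simp [scons, Seq.seq, eq_comm]
  | comp _ _ hf hg =>
    intro i o
    exact ((hg (i + 1) 0).and (hf 0 (o + 1))).ex.congr fun x => Part.mem_bind_iff
  | @prec f g _ _ hf hg =>
    intro i o
    have hT : Enumerable fun x => x 2 ∈ g (Nat.pair (x 4) (Nat.pair (x 0) (x 1))) := by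
      refine ((natPair 2 3 0).and ((natPair 6 0 1).and (hg 1 4))).ex.ex.congr fun x => ?_
      simp [scons]
    -- after the two quantifiers, the entries `1` and `0` are the two components of the argument
    refine ((natPair 1 0 (i + 2)).and (iter (I := fun b x => b ∈ f (x 1))
      (T := fun k a b x => b ∈ g (Nat.pair (x 1) (Nat.pair k a)))
      (hf 2 0) hT 0 (o + 2))).ex.ex.congr fun x => ?_
    have key : ∀ a n b, IterRel (fun b => b ∈ f a) (fun k c b => b ∈ g (Nat.pair a (Nat.pair k c)))
        n b ↔ b ∈ (n.rec (f a) fun y IH => IH.bind fun i => g (Nat.pair a (Nat.pair y i)) :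
          Part ℕ) := by
      intro a n
      induction n with
      | zero => simp [IterRel]
      | succ n ih => intro b; simp [IterRel, ih]
    simp only [scons, Nat.unpaired]
    constructor
    · intro h
      exact ⟨(x i).unpair.1, (x i).unpair.2, (Nat.pair_unpair _).symm, (key _ _ _).2 h⟩
    · rintro ⟨a, n, hx, h⟩
      rw [hx, Nat.unpair_pair]
      exact (key _ _ _).1 h
  | @rfind f _ hf =>
    intro i o
    -- an iteration with constant value `0` that is blocked by the first zero of `f`
    have hT : Enumerable fun x => x 2 = 0 ∧ ∃ y, y + 1 ∈ f (Nat.pair (x (i + 4)) (x 0)) := by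
      refine ((zero 2).and ((natPair (i + 7) 3 2).and ((succ 1 0).and
        (hf 2 0))).ex.ex.ex).congr fun x => ?_
      simp [scons]
    refine (((natPair (i + 2) (o + 2) 1).and ((zero 0).and (hf 1 0))).ex.ex.and
      (iter (I := fun b x => b = 0)
        (T := fun k _ b x => b = 0 ∧ ∃ y, y + 1 ∈ f (Nat.pair (x (i + 1)) k))
        (zero 0) hT (o + 1) 0).ex).congr fun x => ?_
    have key : ∀ a n b, IterRel (fun b => b = 0)
        (fun k _ b => b = 0 ∧ ∃ y, y + 1 ∈ f (Nat.pair a k)) n b ↔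
        b = 0 ∧ ∀ k < n, ∃ y, y + 1 ∈ f (Nat.pair a k) := by
      intro a n
      induction n with
      | zero => simp [IterRel]
      | succ n ih =>
        intro b
        simp only [IterRel, ih, Nat.lt_succ_iff_lt_or_eq, or_imp, forall_and, forall_eq]
        constructor
        · rintro ⟨_, ⟨-, h⟩, hb, h'⟩
          exact ⟨hb, h, h'⟩
        · rintro ⟨hb, h, h'⟩
          exact ⟨0, ⟨rfl, h⟩, hb, h'⟩
    simp only [scons, key, exists_eq_left]
    refine Nat.mem_rfind.trans (and_congr ?_ ?_)
    · simp [Part.mem_map_iff]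
    · have : ∀ k, false ∈ (fun m => decide (m = 0)) <$> f (Nat.pair (x i) k) ↔
          ∃ y, y + 1 ∈ f (Nat.pair (x i) k) := by
        intro k
        simp only [Part.map_eq_map, Part.mem_map_iff, decide_eq_false_iff_not]
        constructor
        · rintro ⟨y, hy, h⟩
          exact ⟨y - 1, by rwa [Nat.sub_add_cancel (Nat.pos_of_ne_zero h)]⟩
        · rintro ⟨y, hy⟩
          exact ⟨y + 1, hy, y.succ_ne_zero⟩
      simp only [this]

/-- The domain of every partial recursive function is accepted by a counter program, which
clears its store. -/
theorem exists_prog {f : ℕ →. ℕ} (hf : Nat.Partrec f) :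
    ∃ p : Prog, ∀ m t, p.Rel (update 0 0 m) t ↔ t = 0 ∧ (f m).Dom := by
  obtain ⟨p, hp⟩ := (graph hf 1 0).ex 1 0 (by simp)
  refine ⟨.seq p (.clear 0), fun m t => ?_⟩
  have hz : ∀ r, 1 ≤ r → update (0 : ℕ → ℕ) 0 m r = 0 := fun r hr => by
    rw [update_of_ne (by omega), Pi.zero_apply]
  have h0 : update (update (0 : ℕ → ℕ) 0 m) 0 0 = 0 := by
    rw [update_idem]; exact update_eq_self 0 _
  have hd : (f m).Dom ↔ ∃ y, y ∈ f m := Part.dom_iff_mem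
  constructor
  · rintro ⟨_, h₁, h₂⟩
    obtain ⟨rfl, h⟩ := (hp _ hz _).1 h₁
    obtain rfl := Prog.rel_clear.1 h₂
    exact ⟨h0, hd.2 (by simpa [scons] using h)⟩
  · rintro ⟨rfl, h⟩
    refine ⟨_, (hp _ hz _).2 ⟨rfl, by simpa [scons] using hd.1 h⟩, Prog.rel_clear.2 h0.symm⟩

end Enumerable
end CounterProgram

/-! ### Nets -/

namespace CounterProgram

open Function Relation

/-- A transition of a Petri net with `n` places: it takes `need x` tokens from each place `x`
and puts `make x` tokens there. It may fire only if the place `test` holds no further tokens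
besides the needed ones. -/
structure Rule (n : ℕ) where
  need : Fin n → ℕ
  make : Fin n → ℕ
  test : Fin n

namespace Rule

variable {n : ℕ} (τ : Rule n) (c : Fin n → ℕ)

def Enabled : Prop := τ.need ≤ c ∧ c τ.test = τ.need τ.test

def fire : Fin n → ℕ := c - τ.need + τ.make

open Classical in
/-- The transition fires if this is possible, and otherwise nothing happens. -/
noncomputable def step : Fin n → ℕ := if τ.Enabled c then τ.fire c else c

end Rule

/-- The reachability relation of a net. -/
def Reaches {n : ℕ} (rules : List (Rule n)) : (Fin n → ℕ) → (Fin n → ℕ) → Prop :=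
  ReflTransGen fun c c' => ∃ τ ∈ rules, c' = τ.step c

/-! ### Compilation of programs to nets -/

/-- An edge of the control-flow graph of a program. A control state is the list of the programs
that remain to be executed. -/
structure Edge where
  src : List Prog
  act : Action
  tgt : List Prog

/-- The edges used by the execution of `p` followed by the programs in `k`. -/
def Prog.edges : Prog → List Prog → List Edge
  | act a, k => [⟨act a :: k, a, k⟩]
  | seq p q, k => ⟨seq p q :: k, .nop, p :: q :: k⟩ :: (p.edges (q :: k) ++ q.edges k)
  | alt p q, k => ⟨alt p q :: k, .nop, p :: k⟩ :: ⟨alt p q :: k, .nop, q :: k⟩ ::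
      (p.edges k ++ q.edges k)
  | star p, k => ⟨star p :: k, .nop, k⟩ :: ⟨star p :: k, .nop, p :: star p :: k⟩ ::
      p.edges (star p :: k)

/-- The effect of executing a list of programs one after the other. -/
def RelList : List Prog → (ℕ → ℕ) → (ℕ → ℕ) → Prop
  | [] => Eq
  | p :: k => Relation.Comp p.Rel (RelList k)

theorem Prog.mem_edges_src (p : Prog) (k : List Prog) : ∃ e ∈ p.edges k, e.src = p :: k := by
  cases p <;> simp [Prog.edges]

theorem Prog.edges_src_ne_nil (p : Prog) (k : List Prog) {e : Edge} (he : e ∈ p.edges k) :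
    e.src ≠ [] := by
  induction p generalizing k <;> simp only [Prog.edges, List.mem_cons, List.mem_append,
    List.not_mem_nil, or_false] at he <;> grind

/-- The control states that occur are `k` and the sources of edges. -/
theorem Prog.edges_tgt (p : Prog) (k : List Prog) {e : Edge} (he : e ∈ p.edges k) :
    e.tgt = k ∨ ∃ e' ∈ p.edges k, e'.src = e.tgt := by
  induction p generalizing k with
  | act a => simp_all [Prog.edges]
  | seq p q ihp ihq =>
    simp only [Prog.edges, List.mem_cons, List.mem_append] at he ⊢
    obtain ⟨e₁, h₁, h₁'⟩ := p.mem_edges_src (q :: k)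
    obtain ⟨e₂, h₂, h₂'⟩ := q.mem_edges_src k
    rcases he with rfl | he | he
    · exact .inr ⟨e₁, .inr (.inl h₁), h₁'⟩
    · rcases ihp _ he with h | ⟨e', h, h'⟩
      · exact .inr ⟨e₂, .inr (.inr h₂), h ▸ h₂'⟩
      · exact .inr ⟨e', .inr (.inl h), h'⟩
    · rcases ihq _ he with h | ⟨e', h, h'⟩
      · exact .inl h
      · exact .inr ⟨e', .inr (.inr h), h'⟩
  | alt p q ihp ihq =>
    simp only [Prog.edges, List.mem_cons, List.mem_append] at he ⊢
    obtain ⟨e₁, h₁, h₁'⟩ := p.mem_edges_src k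
    obtain ⟨e₂, h₂, h₂'⟩ := q.mem_edges_src k
    rcases he with rfl | rfl | he | he
    · exact .inr ⟨e₁, .inr (.inr (.inl h₁)), h₁'⟩
    · exact .inr ⟨e₂, .inr (.inr (.inr h₂)), h₂'⟩
    · rcases ihp _ he with h | ⟨e', h, h'⟩
      · exact .inl h
      · exact .inr ⟨e', .inr (.inr (.inl h)), h'⟩
    · rcases ihq _ he with h | ⟨e', h, h'⟩
      · exact .inl h
      · exact .inr ⟨e', .inr (.inr (.inr h)), h'⟩
  | star p ih =>
    simp only [Prog.edges, List.mem_cons] at he ⊢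
    obtain ⟨e₁, h₁, h₁'⟩ := p.mem_edges_src (star p :: k)
    rcases he with rfl | rfl | he
    · exact .inl rfl
    · exact .inr ⟨e₁, .inr (.inr h₁), h₁'⟩
    · rcases ih _ he with h | ⟨e', h, h'⟩
      · exact .inr ⟨_, .inl rfl, h.symm⟩
      · exact .inr ⟨e', .inr (.inr h), h'⟩

/-- Executing the list of programs that is the current control state is compatible with all edges,
so that every path in the control-flow graph ends in a store that the programs can produce. -/
theorem Prog.edges_sound (p : Prog) (k : List Prog) {e : Edge} (he : e ∈ p.edges k)
    {s t u : ℕ → ℕ} (h : e.act.Rel s t) (h' : RelList e.tgt t u) : RelList e.src s u := by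
  induction p generalizing k with
  | act a =>
    obtain rfl : e = _ := by simpa [Prog.edges] using he
    exact ⟨t, h, h'⟩
  | seq p q ihp ihq =>
    simp only [Prog.edges, List.mem_cons, List.mem_append] at he
    rcases he with rfl | he | he
    · obtain rfl : t = s := h
      obtain ⟨_, h₁, _, h₂, h₃⟩ := h'
      exact ⟨_, ⟨_, h₁, h₂⟩, h₃⟩
    · exact ihp _ he
    · exact ihq _ he
  | alt p q ihp ihq =>
    simp only [Prog.edges, List.mem_cons, List.mem_append] at he
    rcases he with rfl | rfl | he | he
    · obtain rfl : t = s := h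
      obtain ⟨_, h₁, h₂⟩ := h'
      exact ⟨_, .inl h₁, h₂⟩
    · obtain rfl : t = s := h
      obtain ⟨_, h₁, h₂⟩ := h'
      exact ⟨_, .inr h₁, h₂⟩
    · exact ihp _ he
    · exact ihq _ he
  | star p ih =>
    simp only [Prog.edges, List.mem_cons] at he
    rcases he with rfl | rfl | he
    · obtain rfl : t = s := h
      exact ⟨_, ReflTransGen.refl, h'⟩
    · obtain rfl : t = s := h
      obtain ⟨_, h₁, _, h₂, h₃⟩ := h'
      exact ⟨_, ReflTransGen.head h₁ h₂, h₃⟩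
    · exact ih _ he

/-- A step in the control-flow graph `δ`. -/
def EdgeStep (δ : List Edge) (a b : List Prog × (ℕ → ℕ)) : Prop :=
  ∃ e ∈ δ, e.src = a.1 ∧ e.tgt = b.1 ∧ e.act.Rel a.2 b.2

theorem Prog.edges_complete (p : Prog) (k : List Prog) {δ : List Edge} (hδ : p.edges k ⊆ δ)
    {s t : ℕ → ℕ} (h : p.Rel s t) : ReflTransGen (EdgeStep δ) (p :: k, s) (k, t) := by
  induction p generalizing k s t with
  | act a => exact .single ⟨_, hδ (List.mem_singleton_self _), rfl, rfl, h⟩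
  | seq p q ihp ihq =>
    obtain ⟨m, h₁, h₂⟩ := h
    simp only [Prog.edges, List.cons_subset, List.append_subset] at hδ
    exact .head (b := (p :: q :: k, s)) ⟨_, hδ.1, rfl, rfl, rfl⟩
      ((ihp _ hδ.2.1 h₁).trans (ihq _ hδ.2.2 h₂))
  | alt p q ihp ihq =>
    simp only [Prog.edges, List.cons_subset, List.append_subset] at hδ
    rcases h with h | h
    · exact .head (b := (p :: k, s)) ⟨_, hδ.1, rfl, rfl, rfl⟩ (ihp _ hδ.2.2.1 h)
    · exact .head (b := (q :: k, s)) ⟨_, hδ.2.1, rfl, rfl, rfl⟩ (ihq _ hδ.2.2.2 h)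
  | star p ih =>
    simp only [Prog.edges, List.cons_subset] at hδ
    induction (h : ReflTransGen p.Rel s t) using ReflTransGen.head_induction_on with
    | refl => exact .single ⟨_, hδ.1, rfl, rfl, rfl⟩
    | @head a _ h _ ih' =>
      exact .head (b := (p :: star p :: k, a)) ⟨_, hδ.2.1, rfl, rfl, rfl⟩
        ((ih _ hδ.2.2 h).trans ih')

/-- The only register that an action involves (for `nop` the value is immaterial). -/
def Action.reg : Action → ℕ
  | nop => 0
  | inc r => r
  | dec r => r
  | zero r => r

/-- The tokens that an action removes from the registers. -/
def Action.takes : Action → ℕ → ℕ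
  | dec r => fun x => if x = r then 1 else 0
  | _ => 0

/-- The tokens that an action adds to the registers. -/
def Action.makes : Action → ℕ → ℕ
  | inc r => fun x => if x = r then 1 else 0
  | _ => 0

section Net

variable (W : ℕ) (δ : List Edge)

open Classical in
/-- The place of a control state: the places up to `W` are the registers, and the next ones
belong to the sources of the edges. -/
noncomputable def ctrl (k : List Prog) : ℕ := W + 1 + (δ.map Edge.src).idxOf k

/-- The marking with a single token, in the place of the control state `k`. -/
noncomputable def token (k : List Prog) (x : ℕ) : ℕ := if x = ctrl W δ k then 1 else 0

/-- The marking of the net that stands for the store `s` in the control state `k`. The empty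
control state has no place, because the value of `ctrl` is out of range then. -/
noncomputable def marking (k : List Prog) (s : ℕ → ℕ) (x : Fin (W + δ.length + 1)) : ℕ :=
  (if (x : ℕ) ≤ W then s x else 0) + token W δ k x

/-- The rule of an edge moves the control token and performs the action on the registers. Testing
the control place of the source imposes no condition, since this place never holds more than the
one token that is needed; so this is the test of the actions other than `zero`. -/
noncomputable def Edge.rule (e : Edge) : Rule (W + δ.length + 1) where
  need x := token W δ e.src x + e.act.takes x
  make x := token W δ e.tgt x + e.act.makes x
  test := Fin.ofNat _ (match e.act with
    | .zero r => r
    | _ => ctrl W δ e.src)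

variable {W δ}

theorem lt_ctrl (k : List Prog) : W < ctrl W δ k := by unfold ctrl; omega

theorem ctrl_lt {e : Edge} (he : e ∈ δ) : ctrl W δ e.src < W + δ.length + 1 := by
  classical
  have : (δ.map Edge.src).idxOf e.src < (δ.map Edge.src).length :=
    List.idxOf_lt_length_of_mem (List.mem_map_of_mem he)
  simp only [List.length_map] at this
  unfold ctrl
  convert (show W + 1 + (δ.map Edge.src).idxOf e.src < W + δ.length + 1 by omega)

theorem ctrl_inj {e : Edge} (he : e ∈ δ) {k : List Prog} (h : ctrl W δ e.src = ctrl W δ k) :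
    e.src = k := by
  classical
  unfold ctrl at h
  exact (List.idxOf_inj (List.mem_map_of_mem he)).1 (Nat.add_left_cancel h)

theorem test_val {e : Edge} (he : e ∈ δ) (hW : e.act.reg ≤ W) :
    ((e.rule W δ).test : ℕ) = match e.act with
      | .zero r => r
      | _ => ctrl W δ e.src := by
  have := ctrl_lt (W := W) he
  obtain ⟨k, a, k'⟩ := e
  cases a <;> simp only [Action.reg] at hW <;> exact Nat.mod_eq_of_lt (by grind)

/-- Every step along an edge is simulated by the rule of the edge. -/
theorem rule_fire {e : Edge} (he : e ∈ δ) (hW : e.act.reg ≤ W) {s t : ℕ → ℕ}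
    (h : e.act.Rel s t) : (e.rule W δ).Enabled (marking W δ e.src s) ∧
      (e.rule W δ).fire (marking W δ e.src s) = marking W δ e.tgt t := by
  have h₁ := lt_ctrl (W := W) (δ := δ) e.src
  have h₂ := ctrl_lt (W := W) he
  have h₃ := lt_ctrl (W := W) (δ := δ) e.tgt
  obtain ⟨k, a, k'⟩ := e
  simp only at h₁ h₂ h₃
  refine ⟨⟨fun x => ?_, ?_⟩, funext fun x => ?_⟩
  · cases a <;> simp only [Action.Rel, Action.reg] at h hW <;>
      simp only [Edge.rule, marking, Action.takes, Pi.zero_apply] <;> grind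
  · have hx := test_val he hW
    generalize (Edge.rule W δ ⟨k, a, k'⟩).test = x at hx
    cases a <;> simp only [Action.Rel, Action.reg] at h hW <;>
      simp only [Edge.rule, marking, Action.takes, Pi.zero_apply, token] <;> grind
  · cases a <;> simp only [Action.Rel, Action.reg] at h hW <;>
      simp only [Edge.rule, Rule.fire, marking, Action.takes, Action.makes, Pi.zero_apply,
        Pi.add_apply, Pi.sub_apply, update_apply, h] <;> grind

/-- Conversely, the net cannot do anything else: the token of the control state forces the edge to
start there, and the remaining needed or tested tokens make the action possible. -/
theorem exists_rel_of_enabled {e : Edge} (he : e ∈ δ) (hW : e.act.reg ≤ W) {k : List Prog}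
    {s : ℕ → ℕ} (h : (e.rule W δ).Enabled (marking W δ k s)) :
    e.src = k ∧ ∃ t, e.act.Rel s t := by
  have h₁ := lt_ctrl (W := W) (δ := δ) e.src
  have h₂ := ctrl_lt (W := W) he
  have hk : e.src = k := by
    refine ctrl_inj (W := W) he ?_
    have h₀ := h.1 ⟨_, h₂⟩
    simp only [Edge.rule, marking, token] at h₀
    rw [if_neg (show ¬ ctrl W δ e.src ≤ W by omega)] at h₀
    by_contra hne
    rw [if_neg hne] at h₀
    simp at h₀
  refine ⟨hk, ?_⟩
  subst hk
  obtain ⟨k, a, k'⟩ := e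
  simp only at h₁ h₂
  cases a with
  | nop => exact ⟨_, rfl⟩
  | inc r => exact ⟨_, rfl⟩
  | dec r =>
    refine ⟨_, ?_, rfl⟩
    simp only [Action.reg] at hW
    have h₀ := h.1 ⟨r, by omega⟩
    simp only [Edge.rule, marking, token, Action.takes, if_pos hW] at h₀
    simp at h₀
    omega
  | zero r =>
    refine ⟨_, ?_, rfl⟩
    simp only [Action.reg] at hW
    have h₀ := h.2
    have hx := test_val he hW
    generalize (Edge.rule W δ ⟨k, .zero r, k'⟩).test = x at hx h₀
    simp only at hx
    simp only [Edge.rule, marking, Action.takes, Pi.zero_apply, hx, if_pos hW] at h₀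
    omega

/-- The net empties itself exactly if the program can terminate with all registers zero. -/
theorem reaches_zero_iff {p : Prog} (hW : ∀ e ∈ p.edges [], e.act.reg ≤ W) (s : ℕ → ℕ) :
    Reaches ((p.edges []).map (Edge.rule W (p.edges []))) (marking W (p.edges []) [p] s) 0 ↔
      ∃ t, p.Rel s t ∧ ∀ x ≤ W, t x = 0 := by
  set δ := p.edges [] with hδ
  constructor
  · have key : ∀ c, Reaches (δ.map (Edge.rule W δ)) c 0 → ∀ k s, (k = [] ∨ ∃ e ∈ δ, e.src = k) →
        c = marking W δ k s → ∃ t, RelList k s t ∧ ∀ x ≤ W, t x = 0 := by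
      intro c h
      induction h using ReflTransGen.head_induction_on with
      | refl =>
        intro k s hk h
        have hk' : k = [] := by
          refine hk.resolve_right ?_
          rintro ⟨e, he, rfl⟩
          have := congrFun h ⟨_, ctrl_lt he⟩
          simp [marking, token] at this
        subst hk'
        refine ⟨s, rfl, fun x hx => ?_⟩
        have := congrFun h ⟨x, by omega⟩
        simp only [marking, if_pos hx, Pi.zero_apply] at this
        omega
      | head h _ ih =>
        rintro k s hk rfl
        obtain ⟨τ, hτ, rfl⟩ := h
        obtain ⟨e, he, rfl⟩ := List.mem_map.1 hτ
        unfold Rule.step at ih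
        split_ifs at ih with hen
        · obtain ⟨rfl, t, ht⟩ := exists_rel_of_enabled he (hW e he) hen
          obtain ⟨u, hu, hu'⟩ := ih e.tgt t (p.edges_tgt [] he) (rule_fire he (hW e he) ht).2
          exact ⟨u, p.edges_sound [] he ht hu, hu'⟩
        · exact ih k s hk rfl
    intro h
    obtain ⟨t, ⟨_, ht, rfl⟩, ht'⟩ := key _ h [p] s (.inr (p.mem_edges_src [])) rfl
    exact ⟨_, ht, ht'⟩
  · rintro ⟨t, ht, ht'⟩
    have h₀ : marking W δ [] t = 0 := by
      funext x
      have hc : ctrl W δ [] = W + 1 + δ.length := by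
        classical
        unfold ctrl
        rw [List.idxOf_eq_length]
        · simp
        · intro h
          obtain ⟨e, he, he'⟩ := List.mem_map.1 h
          exact p.edges_src_ne_nil [] he he'
      have hx := x.2
      simp only [marking, token, Pi.zero_apply, Nat.add_eq_zero_iff, ite_eq_right_iff]
      exact ⟨ht' x, by omega⟩
    rw [← h₀]
    refine ReflTransGen.lift (fun a : List Prog × (ℕ → ℕ) => marking W δ a.1 a.2) ?_ _ _
      (p.edges_complete [] (List.Subset.refl δ) ht)
    rintro ⟨k, s⟩ ⟨k', s'⟩ ⟨e, he, rfl, rfl, h⟩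
    refine ⟨_, List.mem_map_of_mem he, ?_⟩
    have := rule_fire he (hW e he) h
    simp only [Rule.step, if_pos this.1, this.2]

end Net

/-- The domain of every partial recursive function is a reachability problem for a fixed net, where
only the number of tokens in the first place varies. -/
theorem exists_net {f : ℕ →. ℕ} (hf : Nat.Partrec f) :
    ∃ (n : ℕ) (rules : List (Rule (n + 1))) (c : Fin n → ℕ), ∀ m : ℕ,
      Reaches rules (Fin.cons m c : Fin (n + 1) → ℕ) 0 ↔ (f m).Dom := by
  obtain ⟨p, hp⟩ := Enumerable.exists_prog hf
  obtain ⟨W, hW⟩ : ∃ W, ∀ e ∈ p.edges [], e.act.reg ≤ W := by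
    obtain ⟨W, hW⟩ := ((p.edges []).map fun e => e.act.reg).finite_toSet.bddAbove
    exact ⟨W, fun e he => hW (List.mem_map.2 ⟨e, he, rfl⟩)⟩
  refine ⟨W + (p.edges []).length, (p.edges []).map (Edge.rule W (p.edges [])),
    fun x => marking W (p.edges []) [p] 0 x.succ, fun m => ?_⟩
  have hm : (Fin.cons m fun x => marking W (p.edges []) [p] 0 x.succ) =
      marking W (p.edges []) [p] (update 0 0 m) := by
    funext x
    refine Fin.cases ?_ (fun x => ?_) x
    · have := lt_ctrl (W := W) (δ := p.edges []) [p]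
      simp [marking, token, (Nat.zero_lt_of_lt this).ne]
    · simp [marking]
  rw [hm, reaches_zero_iff hW]
  simp only [hp]
  constructor
  · rintro ⟨t, ⟨-, h⟩, -⟩
    exact h
  · exact fun h => ⟨0, ⟨rfl, h⟩, fun _ _ => rfl⟩

end CounterProgram

/-! ### Nets as control problems -/

namespace QControl

open CounterProgram Function

variable {n : ℕ}

/-- `D(0)` is the identity. -/
theorem displacementElem_zero (m k : ℕ) : displacementElem 0 m k = if m = k then 1 else 0 := by
  unfold displacementElem
  split_ifs with h
  · subst h
    rw [Finset.sum_eq_single m]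
    · have : (m.factorial : ℝ) ≠ 0 := by positivity
      simp [Real.sqrt_mul_self, this]
    · intro j hj hne
      have : m - j ≠ 0 := by simp at hj; omega
      simp [this]
    · simp
  · rw [Finset.sum_eq_zero, mul_zero]
    intro j hj
    simp only [Finset.mem_range] at hj
    rcases Nat.lt_or_ge j m with hm | hm
    · simp [(Nat.sub_pos_of_lt hm).ne']
    · have : k - j ≠ 0 := by omega
      simp [this]

theorem amplitude_nil (l : ℕ) : amplitude [] l = 0 := by
  simp [amplitude, GaussCode.toComplex, RatCode.toRat]

def oneCode : GaussCode := ((1, 0), (0, 0))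

def negOneCode : GaussCode := ((-1, 0), (0, 0))

theorem toComplex_oneCode : GaussCode.toComplex oneCode = 1 := by
  simp [oneCode, GaussCode.toComplex, RatCode.toRat]

theorem toComplex_negOneCode : GaussCode.toComplex negOneCode = -1 := by
  simp [negOneCode, GaussCode.toComplex, RatCode.toRat]

theorem getD_ofFn (u : Fin n → ℕ) (l : Fin n) : (List.ofFn u).getD l 0 = u l := by
  simp

theorem prod_ite_one {p : Fin n → Prop} [DecidablePred p] [Decidable (∀ l, p l)] :
    (∏ l, if p l then (1 : ℂ) else 0) = if ∀ l, p l then 1 else 0 := by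
  split_ifs with h
  · exact Finset.prod_eq_one fun l _ => if_pos (h l)
  · push Not at h
    obtain ⟨l, hl⟩ := h
    exact Finset.prod_eq_zero (Finset.mem_univ l) (if_neg hl)

theorem idx_eq_iff {x y : Idx 1 n} : x = y ↔ x.2 = y.2 :=
  ⟨fun h => h ▸ rfl, fun h => Prod.ext (Subsingleton.elim _ _) h⟩

/-- The operator `z • ⨂_l S^(u l) (S†)^(v l)` on `n` modes. -/
def shiftTerm (z : GaussCode) (u v : Fin n → ℕ) : KrausTerm where
  coef := z
  row := 0
  col := 0
  disp := []
  up := List.ofFn u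
  down := List.ofFn v

open Classical in
theorem shiftTerm_toOp (z : GaussCode) (u v : Fin n → ℕ) (x y : Idx 1 n) :
    (shiftTerm z u v).toOp 1 n x y =
      z.toComplex * if v ≤ y.2 ∧ x.2 = y.2 - v + u then 1 else 0 := by
  have h : ∀ l : Fin n, shiftElem 0 (u l) (v l) (x.2 l) (y.2 l) =
      if v l ≤ y.2 l ∧ x.2 l = y.2 l - v l + u l then 1 else 0 := by
    intro l
    rw [shiftElem, displacementElem_zero, ite_and]
  have h₀ : (x.1 : ℕ) = 0 ∧ (y.1 : ℕ) = 0 := by omega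
  simp only [KrausTerm.toOp, shiftTerm, h₀, amplitude_nil, getD_ofFn, h, prod_ite_one, and_self,
    if_true]
  congr 1
  simp only [forall_and, funext_iff, Pi.le_def, Pi.add_apply, Pi.sub_apply]

/-- The matrix of the partial map `g` with domain `E` on the basis states. -/
noncomputable def partialMapOp (E : (Fin n → ℕ) → Prop) (g : (Fin n → ℕ) → Fin n → ℕ) : Op 1 n :=
  open Classical in fun x y => if E y.2 ∧ x.2 = g y.2 then 1 else 0

/-- The Kraus map that fires a transition if this is possible. With the unit vector `e` of the
place `τ.test`, the first Kraus operator is the shift by `τ` minus the same shift with one more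
token required in that place, so that it acts only where this token is absent.
The second one is the projection onto the markings in which `τ` is blocked. -/
def ruleControl (τ : Rule n) : ControlCode :=
  let e : Fin n → ℕ := Pi.single τ.test 1
  [[shiftTerm oneCode τ.make τ.need, shiftTerm negOneCode (τ.make + e) (τ.need + e)],
    [shiftTerm (n := n) oneCode 0 0, shiftTerm negOneCode τ.need τ.need,
      shiftTerm oneCode (τ.need + e) (τ.need + e)]]

theorem enabled_iff (τ : Rule n) (c : Fin n → ℕ) :
    τ.Enabled c ↔ τ.need ≤ c ∧ ¬ τ.need + Pi.single τ.test 1 ≤ c := by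
  refine and_congr_right fun h => ⟨fun h' h'' => ?_, fun h' => ?_⟩
  · have := h'' τ.test
    simp [h'] at this
  · by_contra hne
    refine h' fun l => ?_
    by_cases hl : l = τ.test
    · subst hl
      have h₁ : τ.need τ.test ≤ c τ.test := h τ.test
      have h₂ : τ.need τ.test + 1 ≤ c τ.test := by omega
      simpa using h₂
    · simpa [hl] using h l

theorem krausCode_toOp_fire (τ : Rule n) :
    KrausCode.toOp 1 n [shiftTerm oneCode τ.make τ.need,
      shiftTerm negOneCode (τ.make + Pi.single τ.test 1) (τ.need + Pi.single τ.test 1)] =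
    partialMapOp τ.Enabled τ.fire := by
  classical
  funext x y
  simp only [KrausCode.toOp, List.map_cons, List.map_nil, List.sum_cons, List.sum_nil, add_zero,
    shiftTerm_toOp, toComplex_oneCode, toComplex_negOneCode, partialMapOp, enabled_iff, Rule.fire]
  by_cases h : τ.need + Pi.single τ.test 1 ≤ y.2
  · have h' : τ.need ≤ y.2 := le_trans le_self_add h
    have h'' : y.2 - (τ.need + Pi.single τ.test 1) + (τ.make + Pi.single τ.test 1) =
        y.2 - τ.need + τ.make := by
      funext l
      have := h l
      simp only [Pi.add_apply, Pi.sub_apply] at this ⊢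
      omega
    by_cases hx : x.2 = y.2 - τ.need + τ.make <;> simp [h, h', h'', hx]
  · simp [h]

theorem krausCode_toOp_blocked (τ : Rule n) :
    KrausCode.toOp 1 n [shiftTerm (n := n) oneCode 0 0, shiftTerm negOneCode τ.need τ.need,
      shiftTerm oneCode (τ.need + Pi.single τ.test 1) (τ.need + Pi.single τ.test 1)] =
    partialMapOp (fun c => ¬ τ.Enabled c) id := by
  classical
  funext x y
  simp only [KrausCode.toOp, List.map_cons, List.map_nil, List.sum_cons, List.sum_nil, add_zero,
    shiftTerm_toOp, toComplex_oneCode, toComplex_negOneCode, partialMapOp, enabled_iff, id]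
  have h₁ : ∀ v : Fin n → ℕ, (v ≤ y.2 ∧ x.2 = y.2 - v + v) ↔ (v ≤ y.2 ∧ x.2 = y.2) :=
    fun v => and_congr_right fun h => by rw [tsub_add_cancel_of_le h]
  simp only [h₁]
  by_cases h : τ.need + Pi.single τ.test 1 ≤ y.2
  · have h' : τ.need ≤ y.2 := le_trans le_self_add h
    by_cases hx : x.2 = y.2 <;> simp [h, h', hx]
  · by_cases h' : τ.need ≤ y.2 <;> by_cases hx : x.2 = y.2 <;> simp [h, h', hx]

open Classical in
theorem tsum_partialMapOp (E : (Fin n → ℕ) → Prop) (g : (Fin n → ℕ) → Fin n → ℕ) (u v : Idx 1 n) :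
    ∑' x : Idx 1 n, starRingEnd ℂ (partialMapOp E g x u) * partialMapOp E g x v =
      if E u.2 ∧ E v.2 ∧ g u.2 = g v.2 then 1 else 0 := by
  rw [tsum_eq_single (0, g u.2)]
  · by_cases hu : E u.2 <;> simp [partialMapOp, hu]
  · intro x hx
    have : x.2 ≠ g u.2 := fun h => hx (idx_eq_iff.2 h)
    simp [partialMapOp, this]

theorem fire_injOn {τ : Rule n} {c c' : Fin n → ℕ} (h : τ.need ≤ c) (h' : τ.need ≤ c')
    (hf : τ.fire c = τ.fire c') : c = c' :=
  (tsub_left_inj h h').1 (add_right_cancel hf)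

theorem isKrausFamily_ruleControl (τ : Rule n) : IsKrausFamily 1 n (ruleControl τ) := by
  classical
  intro u v
  simp only [ruleControl, List.map_cons, List.map_nil, List.sum_cons, List.sum_nil, add_zero,
    krausCode_toOp_fire, krausCode_toOp_blocked, tsum_partialMapOp, id, idx_eq_iff]
  by_cases huv : u.2 = v.2
  · by_cases h : τ.Enabled v.2 <;> simp [huv, h]
  · have : ¬ (τ.Enabled u.2 ∧ τ.Enabled v.2 ∧ τ.fire u.2 = τ.fire v.2) :=
      fun h => huv (fire_injOn h.1.1 h.2.1.1 h.2.2)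
    simp [huv, this]

open Classical in
/-- The pure state of the number state `c`. -/
noncomputable def basisOp (c : Fin n → ℕ) : Op 1 n :=
  fun x y => if x.2 = c ∧ y.2 = c then 1 else 0

theorem basisOp_injective : Injective (basisOp : (Fin n → ℕ) → Op 1 n) := by
  intro c c' h
  have := congrFun (congrFun h (0, c)) (0, c)
  simpa [basisOp] using this

theorem apply_ruleControl (τ : Rule n) (c : Fin n → ℕ) :
    (ruleControl τ).apply (basisOp c) = basisOp (τ.step c) := by
  classical
  funext x y
  have key : ∀ K : Op 1 n, ∑' q : Idx 1 n × Idx 1 n,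
      K x q.1 * basisOp c q.1 q.2 * starRingEnd ℂ (K y q.2) =
        K x (0, c) * starRingEnd ℂ (K y (0, c)) := by
    intro K
    rw [tsum_eq_single ((0, c), (0, c))]
    · simp [basisOp]
    · rintro ⟨q, q'⟩ hq
      have : ¬ (q.2 = c ∧ q'.2 = c) := fun h =>
        hq (Prod.ext (idx_eq_iff.2 h.1) (idx_eq_iff.2 h.2))
      simp [basisOp, this]
  simp only [ControlCode.apply, ruleControl, List.map_cons, List.map_nil, List.sum_cons,
    List.sum_nil, add_zero, krausCode_toOp_fire, krausCode_toOp_blocked, key]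
  by_cases h : τ.Enabled c
  · simp only [partialMapOp, basisOp, Rule.step, h, true_and, if_true, not_true, false_and, if_false]
    by_cases hx : x.2 = τ.fire c <;> by_cases hy : y.2 = τ.fire c <;> simp [hx, hy]
  · simp only [partialMapOp, basisOp, Rule.step, h, true_and, not_false_eq_true, false_and,
      if_false, id]
    by_cases hx : x.2 = c <;> by_cases hy : y.2 = c <;> simp [hx, hy]

/-- The projection onto the number state with occupation numbers `occ`. -/
def pureCode (occ : List ℕ) : StateCode := [⟨oneCode, ⟨0, occ, []⟩, ⟨0, occ, []⟩⟩]

theorem pureCode_toOp (c : Fin n → ℕ) :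
    StateCode.toOp 1 n (pureCode (List.ofFn c)) = basisOp c := by
  classical
  funext x y
  have h : ∀ x : Idx 1 n, KetCode.toVec 1 n ⟨0, List.ofFn c, []⟩ x = if x.2 = c then 1 else 0 := by
    intro x
    simp only [KetCode.toVec, amplitude_nil, getD_ofFn, displacementElem_zero, prod_ite_one,
      funext_iff]
    simp
  simp only [StateCode.toOp, pureCode, List.map_cons, List.map_nil, List.sum_cons, List.sum_nil,
    add_zero, h, toComplex_oneCode, basisOp]
  by_cases hx : x.2 = c <;> by_cases hy : y.2 = c <;> simp [hx, hy]

theorem pureCode_nil_toOp : StateCode.toOp 1 n (pureCode []) = basisOp 0 := by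
  rw [← pureCode_toOp]
  funext x y
  have h : ∀ l : Fin n, (List.ofFn (0 : Fin n → ℕ)).getD l 0 = ([] : List ℕ).getD l 0 := by
    intro l; rw [getD_ofFn]; rfl
  simp only [StateCode.toOp, pureCode, KetCode.toVec, List.map_cons, List.map_nil, h]

open Classical in
theorem basisOp_eq_diagonal (c : Fin n → ℕ) :
    basisOp c = Matrix.diagonal fun x : Idx 1 n => if x.2 = c then (1 : ℂ) else 0 := by
  funext x y
  simp only [basisOp, Matrix.diagonal_apply, idx_eq_iff]
  by_cases hx : x.2 = c
  · simp [hx, eq_comm]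
  · simp [hx]

theorem isDensity_basisOp (c : Fin n → ℕ) : IsDensity (basisOp c) := by
  classical
  open scoped ComplexOrder in
  refine ⟨?_, ?_⟩
  · rw [basisOp_eq_diagonal]
    refine Matrix.PosSemidef.diagonal fun x => ?_
    simp only [Pi.zero_apply]
    split_ifs <;> simp
  · have : (1 : ℂ) = basisOp c (0, c) (0, c) := by simp [basisOp]
    rw [this]
    refine hasSum_single _ fun x hx => ?_
    have : x.2 ≠ c := fun h => hx (idx_eq_iff.2 h)
    simp [basisOp, this]

/-- The observable `|0⟩⟨0| - 1`, where `|0⟩` is the vacuum. -/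
def vacuumObservable : ObservableCode where
  poly := [⟨negOneCode, 0, 0, [], []⟩]
  finiteRank := pureCode []

open Classical in
theorem vacuumObservable_toOp : vacuumObservable.toOp 1 n =
    -Matrix.diagonal fun x : Idx 1 n => if x.2 = 0 then (0 : ℂ) else 1 := by
  funext x y
  have h : ∀ m k, ladderElem 0 0 m k = if m = k then 1 else 0 := by
    intro m k; simp [ladderElem]
  have h₀ : (x.1 : ℕ) = 0 ∧ (y.1 : ℕ) = 0 := by omega
  have h₁ : ∀ l, ([] : List ℕ).getD l 0 = 0 := fun l => rfl
  simp only [ObservableCode.toOp, vacuumObservable, pureCode_nil_toOp, MonomialCode.toOp,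
    List.map_cons, List.map_nil, List.sum_cons, List.sum_nil, add_zero, h₀, and_self, if_true, h₁, h,
    toComplex_negOneCode, prod_ite_one, basisOp_eq_diagonal, Matrix.neg_apply,
    Matrix.diagonal_apply, ← funext_iff, idx_eq_iff]
  by_cases hx : x.2 = y.2
  · by_cases hy : y.2 = 0 <;> simp [hx, hy]
  · by_cases hx' : x.2 = 0
    · have h' : ¬ 0 = y.2 := hx' ▸ hx
      simp [hx', h']
    · simp [hx]

theorem isNormalizedObservable_vacuumObservable :
    IsNormalizedObservable (vacuumObservable.toOp 1 n) := by
  classical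
  open scoped ComplexOrder in
  rw [vacuumObservable_toOp]
  have hpos : (Matrix.diagonal fun x : Idx 1 n => if x.2 = 0 then (0 : ℂ) else 1).PosSemidef := by
    refine Matrix.PosSemidef.diagonal fun x => ?_
    simp only [Pi.zero_apply]
    split_ifs <;> simp
  refine ⟨hpos.1.neg, IsGreatest.isLUB ⟨?_, ?_⟩⟩
  · refine ⟨Finsupp.single (0, 0) 1, ?_, ?_⟩
    · simp
    · simp
  · rintro r ⟨ψ, -, rfl⟩
    have := (Complex.le_def.1 (hpos.2 ψ)).1
    simp only [Finsupp.sum, Matrix.neg_apply, mul_neg, neg_mul, Finset.sum_neg_distrib,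
      Complex.neg_re, Left.neg_nonpos_iff] at this ⊢
    exact this

open Classical in
theorem traceMul_vacuumObservable (c : Fin n → ℕ) :
    traceMul (vacuumObservable.toOp 1 n) (basisOp c) = if c = 0 then 0 else -1 := by
  rw [traceMul, tsum_eq_single ((0, c), (0, c))]
  · rw [vacuumObservable_toOp]
    by_cases h : c = 0 <;> simp [basisOp, h]
  · rintro ⟨q, q'⟩ hq
    have : ¬ (q'.2 = c ∧ q.2 = c) := fun h =>
      hq (Prod.ext (idx_eq_iff.2 h.2) (idx_eq_iff.2 h.1))
    simp [basisOp, this]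

/-- The actual value is `2`. -/
theorem one_le_hsDistSq {c c' : Fin n → ℕ} (h : c ≠ c') :
    1 ≤ hsDistSq (basisOp c) (basisOp c') := by
  have hs : Summable fun q : Idx 1 n × Idx 1 n =>
      ‖basisOp c q.1 q.2 - basisOp c' q.1 q.2‖ ^ 2 := by
    refine summable_of_hasFiniteSupport (Set.Finite.subset
      (Set.toFinite {((0, c), (0, c)), ((0, c'), (0, c'))}) ?_)
    rintro ⟨q, q'⟩ hq
    simp only [Set.mem_insert_iff, Set.mem_singleton_iff, Prod.mk.injEq, idx_eq_iff]
    by_contra hne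
    rw [not_or] at hne
    simp [basisOp, hne.1, hne.2] at hq
  refine le_trans ?_ (hs.le_tsum ((0, c), (0, c)) fun _ _ => by positivity)
  simp [basisOp, h]

theorem hsDistSq_self (ρ : Op 1 n) : hsDistSq ρ ρ = 0 := by simp [hsDistSq]

/-- The control problem of a net: the initial state is given by the initial marking, the controls
are the transitions, and all policies are accessible. -/
def netSystem (n : ℕ) (rules : List (Rule n)) (occ : List ℕ) : SystemCode where
  levels := 1
  modes := n
  initial := pureCode occ
  controls := rules.map ruleControl
  accessible := none

section netSystem

variable {rules : List (Rule n)} {c : Fin n → ℕ}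

theorem netSystem_valid : (netSystem n rules (List.ofFn c)).Valid := by
  refine ⟨?_, fun K hK => ?_⟩
  · exact (pureCode_toOp c).symm ▸ isDensity_basisOp c
  · obtain ⟨τ, -, rfl⟩ := List.mem_map.1 hK
    exact isKrausFamily_ruleControl τ

theorem exists_propagate_eq {p : List ℕ} (hp : (netSystem n rules (List.ofFn c)).Accessible p) :
    ∃ c', Reaches rules c c' ∧ (netSystem n rules (List.ofFn c)).propagate p = basisOp c' := by
  have key : ∀ p : List ℕ, (∀ i ∈ p, i < rules.length) → ∀ c, ∃ c', Reaches rules c c' ∧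
      p.foldl (fun ρ i => ControlCode.apply ((rules.map ruleControl).getD i []) ρ) (basisOp c) =
        basisOp c' := by
    intro p
    induction p with
    | nil => exact fun _ c => ⟨c, .refl, rfl⟩
    | cons i p ih =>
      intro hp c
      have hi := hp i (by simp)
      obtain ⟨c', h, h'⟩ := ih (fun j hj => hp j (by simp [hj])) (rules[i].step c)
      refine ⟨c', .head ⟨_, List.getElem_mem hi, rfl⟩ h, ?_⟩
      rw [← h', List.foldl_cons, List.getD_eq_getElem _ _ (by simpa using hi), List.getElem_map,
        apply_ruleControl]
  have := key p (by simpa [netSystem] using hp.1) c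
  rwa [← pureCode_toOp c] at this

theorem exists_policy {c' : Fin n → ℕ} (h : Reaches rules c c') :
    ∃ p, (netSystem n rules (List.ofFn c)).Accessible p ∧
      (netSystem n rules (List.ofFn c)).propagate p = basisOp c' := by
  induction h with
  | refl => exact ⟨[], ⟨by simp, by simp [netSystem]⟩, pureCode_toOp c⟩
  | tail _ h ih =>
    obtain ⟨τ, hτ, rfl⟩ := h
    obtain ⟨p, hp, hp'⟩ := ih
    obtain ⟨i, hi, rfl⟩ := List.getElem_of_mem hτ
    refine ⟨p ++ [i], ⟨?_, by simp [netSystem]⟩, ?_⟩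
    · intro j hj
      rcases List.mem_append.1 hj with hj | hj
      · exact hp.1 j hj
      · rw [List.mem_singleton.1 hj]
        simpa [netSystem] using hi
    · rw [← apply_ruleControl, ← hp', SystemCode.propagate, List.foldl_append]
      have : (netSystem n rules (List.ofFn c)).controls.getD i [] = ruleControl rules[i] := by
        simp only [netSystem]
        rw [List.getD_eq_getElem _ _ (by simpa using hi), List.getElem_map]
      simp only [List.foldl_cons, List.foldl_nil, this]
      rfl

/-- Maximizing the occupation of the vacuum, which is the empty marking. -/
def netExpectation (n : ℕ) (rules : List (Rule n)) (occ : List ℕ) : ExpectationProblem :=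
  ⟨netSystem n rules occ, vacuumObservable⟩

/-- Preparing the vacuum, which is the empty marking. -/
def netPreparation (n : ℕ) (rules : List (Rule n)) (occ : List ℕ) : PreparationProblem :=
  ⟨netSystem n rules occ, pureCode []⟩

theorem netExpectation_valid : (netExpectation n rules (List.ofFn c)).Valid :=
  ⟨netSystem_valid, isNormalizedObservable_vacuumObservable⟩

theorem netPreparation_valid : (netPreparation n rules (List.ofFn c)).Valid := by
  refine ⟨netSystem_valid, ?_⟩
  have : (netPreparation n rules (List.ofFn c)).targetOp = basisOp 0 := pureCode_nil_toOp
  rw [this]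
  exact isDensity_basisOp 0

open Classical in
theorem netExpectation_objective {p : List ℕ} {c' : Fin n → ℕ}
    (h : (netSystem n rules (List.ofFn c)).propagate p = basisOp c') :
    (netExpectation n rules (List.ofFn c)).objective p = if c' = 0 then 0 else -1 := by
  have : (netExpectation n rules (List.ofFn c)).objective p =
      (traceMul (vacuumObservable.toOp 1 n) (basisOp c')).re := by rw [← h]; rfl
  rw [this, traceMul_vacuumObservable]
  split_ifs <;> simp

theorem netExpectation_integerValued : (netExpectation n rules (List.ofFn c)).IntegerValued := by
  intro p hp
  obtain ⟨c', -, h⟩ := exists_propagate_eq hp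
  rw [netExpectation_objective h]
  split_ifs
  exacts [⟨0, by simp⟩, ⟨1, by simp⟩]

theorem netExpectation_approxSolvable_iff {ε : ℝ} (h₀ : 0 ≤ ε) (h₁ : ε < 1) :
    (netExpectation n rules (List.ofFn c)).ApproxSolvable ε ↔ Reaches rules c 0 := by
  constructor
  · rintro ⟨p, hp, hε, -⟩
    obtain ⟨c', hc, h⟩ := exists_propagate_eq hp
    rw [netExpectation_objective h] at hε
    split_ifs at hε with h0
    · exact h0 ▸ hc
    · linarith
  · intro h
    obtain ⟨p, hp, h⟩ := exists_policy h
    refine ⟨p, hp, ?_⟩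
    rw [netExpectation_objective h]
    simpa using h₀

theorem netExpectation_solvable_iff :
    (netExpectation n rules (List.ofFn c)).Solvable ↔ Reaches rules c 0 := by
  rw [← netExpectation_approxSolvable_iff le_rfl one_pos]
  simp only [ExpectationProblem.Solvable, ExpectationProblem.ApproxSolvable, neg_zero,
    ← ge_antisymm_iff]

theorem netPreparation_solvable_iff :
    (netPreparation n rules (List.ofFn c)).Solvable ↔ Reaches rules c 0 := by
  have ht : (netPreparation n rules (List.ofFn c)).targetOp = basisOp 0 := pureCode_nil_toOp
  constructor
  · rintro ⟨p, hp, hpt⟩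
    obtain ⟨c', hc, h⟩ := exists_propagate_eq hp
    have h₀ : c' = 0 := basisOp_injective (h.symm.trans (hpt.trans ht))
    exact h₀ ▸ hc
  · intro h
    obtain ⟨p, hp, h⟩ := exists_policy h
    exact ⟨p, hp, h.trans ht.symm⟩

theorem netPreparation_approxSolvable_iff {ε : ℝ} (h₀ : 0 < ε) (h₁ : ε < 1) :
    (netPreparation n rules (List.ofFn c)).ApproxSolvable ε ↔ Reaches rules c 0 := by
  have ho : ∀ p c', (netSystem n rules (List.ofFn c)).propagate p = basisOp c' →
      (netPreparation n rules (List.ofFn c)).objective p = hsDistSq (basisOp c') (basisOp 0) := by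
    intro p c' h
    rw [← h, ← pureCode_nil_toOp]
    rfl
  constructor
  · rintro ⟨p, hp, hε⟩
    obtain ⟨c', hc, h⟩ := exists_propagate_eq hp
    rw [ho p c' h] at hε
    by_contra hne
    have : c' ≠ 0 := fun h0 => hne (h0 ▸ hc)
    exact absurd hε (not_lt.2 (h₁.le.trans (one_le_hsDistSq this)))
  · intro h
    obtain ⟨p, hp, h⟩ := exists_policy h
    refine ⟨p, hp, ?_⟩
    rw [ho p 0 h, hsDistSq_self]
    exact h₀

end netSystem
end QControl

/-! ### Undecidability -/

namespace QControl

open CounterProgram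

/-- The halting problem for a fixed partial recursive function: only the argument varies. -/
theorem exists_undecidable_domain :
    ∃ f : ℕ →. ℕ, Nat.Partrec f ∧ ¬ ComputablePred fun m => (f m).Dom := by
  -- `m` is read as the code of a program, which is run on the input `0`
  refine ⟨fun m => (Denumerable.ofNat Nat.Partrec.Code m).eval 0, ?_, fun h => ?_⟩
  · refine Partrec.nat_iff.1 (Nat.Partrec.Code.eval_part.comp (Computable.ofNat _)
      (Computable.const 0))
  · refine ComputablePred.halting_problem 0 (ComputablePred.computable_of_manyOneReducible
      ⟨Encodable.encode, Computable.encode, fun c => ?_⟩ h)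
    beta_reduce
    rw [Denumerable.ofNat_encode]

/-- An algorithm that is only required to be correct on the instances described by `inst` can
still be composed with a computable map `F` all of whose values are such instances. -/
theorem not_algorithmicallyDecidable_of_reduction {α : Type} [Primcodable α] {inst yes : α → Prop}
    {P : ℕ → Prop} (hP : ¬ ComputablePred P) {F : ℕ → α} (hF : Computable F)
    (hinst : ∀ m, inst (F m)) (hyes : ∀ m, yes (F m) ↔ P m) :
    ¬ AlgorithmicallyDecidable inst yes := by
  classical
  rintro ⟨f, hf, h⟩
  refine hP ⟨inferInstance, ?_⟩
  have h₁ : Partrec fun m => f (F m) := hf.comp hF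
  refine h₁.of_eq fun m => ?_
  obtain ⟨b, hb, hb'⟩ := h (F m) (hinst m)
  rw [hyes] at hb'
  refine Part.eq_some_iff.2 ?_
  convert hb
  rw [Bool.eq_iff_iff, decide_eq_true_iff, hb']

theorem primrec_pureCode : Primrec pureCode := by
  have hk : Primrec fun l : List ℕ => (⟨0, l, []⟩ : KetCode) :=
    (Primrec.of_equiv_symm (e := ⟨fun s : KetCode => (s.level, s.occ, s.disp),
      fun t => ⟨t.1, t.2.1, t.2.2⟩, fun _ => rfl, fun _ => rfl⟩)).comp
      ((Primrec.const 0).pair (Primrec.id.pair (Primrec.const [])))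
  have hd : Primrec fun l : List ℕ => (⟨oneCode, ⟨0, l, []⟩, ⟨0, l, []⟩⟩ : DyadCode) :=
    (Primrec.of_equiv_symm (e := ⟨fun s : DyadCode => (s.coef, s.ket, s.bra),
      fun t => ⟨t.1, t.2.1, t.2.2⟩, fun _ => rfl, fun _ => rfl⟩)).comp
      ((Primrec.const oneCode).pair (hk.pair hk))
  exact Primrec.list_cons.comp hd (Primrec.const [])

theorem primrec_netSystem (n : ℕ) (rules : List (Rule n)) : Primrec (netSystem n rules) :=
  (Primrec.of_equiv_symm (e := ⟨fun s : SystemCode =>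
      (s.levels, s.modes, s.initial, s.controls, s.accessible),
      fun t => ⟨t.1, t.2.1, t.2.2.1, t.2.2.2.1, t.2.2.2.2⟩, fun _ => rfl, fun _ => rfl⟩)).comp
    ((Primrec.const 1).pair ((Primrec.const n).pair (primrec_pureCode.pair
      ((Primrec.const (rules.map ruleControl)).pair (Primrec.const none)))))

theorem primrec_netExpectation (n : ℕ) (rules : List (Rule n)) :
    Primrec (netExpectation n rules) :=
  (Primrec.of_equiv_symm (e := ⟨fun s : ExpectationProblem => (s.system, s.observable),
      fun t => ⟨t.1, t.2⟩, fun _ => rfl, fun _ => rfl⟩)).comp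
    ((primrec_netSystem n rules).pair (Primrec.const vacuumObservable))

theorem primrec_netPreparation (n : ℕ) (rules : List (Rule n)) :
    Primrec (netPreparation n rules) :=
  (Primrec.of_equiv_symm (e := ⟨fun s : PreparationProblem => (s.system, s.target),
      fun t => ⟨t.1, t.2⟩, fun _ => rfl, fun _ => rfl⟩)).comp
    ((primrec_netSystem n rules).pair (Primrec.const (pureCode [])))

end QControl

theorem mainTheorem1 :
    ¬ QControl.AlgorithmicallyDecidable
        (fun Q : QControl.ExpectationProblem => Q.Valid ∧ Q.IntegerValued)
        (fun Q => Q.Solvable) ∧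
    ¬ QControl.AlgorithmicallyDecidable
        (fun Q : QControl.PreparationProblem => Q.Valid)
        (fun Q => Q.Solvable) ∧
    ∀ ε : ℝ, 0 < ε → ε < 1 →
      ¬ QControl.AlgorithmicallyDecidable
          (fun Q : QControl.ExpectationProblem => Q.Valid ∧ Q.IntegerValued)
          (fun Q => Q.ApproxSolvable ε) ∧
      ¬ QControl.AlgorithmicallyDecidable
          (fun Q : QControl.PreparationProblem => Q.Valid)
          (fun Q => Q.ApproxSolvable ε) := by
  open QControl in
  obtain ⟨f, hf, hnot⟩ := exists_undecidable_domain
  obtain ⟨n, rules, c, hnet⟩ := CounterProgram.exists_net hf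
  have hocc : Primrec fun m : ℕ => m :: List.ofFn c :=
    Primrec.list_cons.comp Primrec.id (Primrec.const _)
  have hE := ((primrec_netExpectation (n + 1) rules).comp hocc).to_comp
  have hP := ((primrec_netPreparation (n + 1) rules).comp hocc).to_comp
  have hcons : ∀ m : ℕ, m :: List.ofFn c = List.ofFn (Fin.cons m c : Fin (n + 1) → ℕ) := by
    intro m; simp [List.ofFn_succ]
  simp only [hcons] at hE hP
  refine ⟨?_, ?_, fun ε h₀ h₁ => ⟨?_, ?_⟩⟩
  · exact not_algorithmicallyDecidable_of_reduction hnot hE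
      (fun m => ⟨netExpectation_valid, netExpectation_integerValued⟩)
      fun m => netExpectation_solvable_iff.trans (hnet m)
  · exact not_algorithmicallyDecidable_of_reduction hnot hP (fun m => netPreparation_valid)
      fun m => netPreparation_solvable_iff.trans (hnet m)
  · exact not_algorithmicallyDecidable_of_reduction hnot hE
      (fun m => ⟨netExpectation_valid, netExpectation_integerValued⟩)
      fun m => (netExpectation_approxSolvable_iff h₀.le h₁).trans (hnet m)
  · exact not_algorithmicallyDecidable_of_reduction hnot hP (fun m => netPreparation_valid)
      fun m => (netPreparation_approxSolvable_iff h₀ h₁).trans (hnet m)
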